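/- Let $x_i$, $i\in\mathbb{Z}$, be i.i.d. standard normal random variables, and let $n=n(p)\ge p$ be a function of the positive integer $p$ such that $p/n\to c$ as $p\to\infty$, where $c\in(0,1]$. Let $\mathbf{X}$ be either the $p\times n$ Toeplitz matrix $\mathbf{X}=(x_{j-i})_{1\le i\le p,\,1\le j\le n}$ or the $p\times n$ rectangular circulant matrix $\mathbf{X}=(x_{(j-i)\bmod n})_{1\le i\le p,\,1\le j\le n}$ (residues in $\{0,\dots,n-1\}$), and let $\lambda_p$ be the smallest eigenvalue of $\mathbf{S}=\frac1n\mathbf{X}\mathbf{X}^\top$. Then, in both cases, for every real $\kappa\ge 1$, the random variable $\lambda_p^\kappa$ is integrable for every $p$ and $\mathbb{E}\big[\lambda_p^{\kappa}\big]\to 0$ as $p\to\infty$. -/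

import Mathlib

open MeasureTheory ProbabilityTheory Filter Topology

noncomputable section

/-- The `p × n` Toeplitz matrix `(x_{j-i})` of a two-sided sequence `x`
(counting rows and columns from `0` does not change `j - i`). -/
def rectToeplitz (x : ℤ → ℝ) (p n : ℕ) : Matrix (Fin p) (Fin n) ℝ :=
  Matrix.of fun i j => x ((j : ℤ) - (i : ℤ))

/-- The `p × n` rectangular circulant matrix `(x_{(j-i) mod n})`, where the residue is taken in
`{0, …, n - 1}`, so that only `x_0, …, x_{n-1}` occur. -/
def rectCirculant (x : ℤ → ℝ) (p n : ℕ) : Matrix (Fin p) (Fin n) ℝ :=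
  Matrix.of fun i j => x (((j : ℤ) - (i : ℤ)) % (n : ℤ))

/-- The matrix `S = (1/n) X Xᵀ`. -/
def sampleCov {p n : ℕ} (X : Matrix (Fin p) (Fin n) ℝ) : Matrix (Fin p) (Fin p) ℝ :=
  (1 / (n : ℝ)) • (X * X.transpose)

/-- The smallest (real) eigenvalue of a square real matrix; it is only used for the symmetric
matrices `S`, whose real spectrum is finite, and nonempty when `p ≥ 1`. -/
def smallestEigenvalue {p : ℕ} (A : Matrix (Fin p) (Fin p) ℝ) : ℝ :=
  sInf (spectrum ℝ A)

/-- For `p ≥ 1`, the number `smallestEigenvalue S` is indeed the least element of the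
spectrum of `S`. -/
theorem isLeast_smallestEigenvalue {p n : ℕ} (hp : 0 < p) (X : Matrix (Fin p) (Fin n) ℝ) :
    IsLeast (spectrum ℝ (sampleCov X)) (smallestEigenvalue (sampleCov X)) := by
  have hA : (sampleCov X).IsHermitian := by
    unfold sampleCov
    rw [Matrix.IsHermitian, Matrix.conjTranspose_eq_transpose_of_trivial]
    simp [Matrix.transpose_mul]
  have hs : spectrum ℝ (sampleCov X) = Set.range hA.eigenvalues :=
    hA.spectrum_real_eq_range_eigenvalues
  haveI : Nonempty (Fin p) := ⟨⟨0, hp⟩⟩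
  have hfin : (spectrum ℝ (sampleCov X)).Finite := by
    rw [hs]; exact Set.finite_range _
  have hne : (spectrum ℝ (sampleCov X)).Nonempty := by
    rw [hs]; exact Set.range_nonempty _
  exact ⟨hne.csInf_mem hfin, fun _ h => csInf_le hfin.bddBelow h⟩

end

/-!
The smallest eigenvalue `Λ` of `S` is at most any Rayleigh quotient of `S`, so it suffices to find
a test vector with a small quotient. Let `N = n` in the circulant case and `N = n + p - 1` in the
Toeplitz case, where `X` consists of the first `n` columns of a `p × N` circulant matrix and
`N ≤ 2 n`. In both cases `Λ * ‖u‖²` is at most `2 / N` times the energy of the circular convolution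
of `u` with a Gaussian noise `f` on `ZMod N`. Testing with truncated characters of frequency `k` and
using Parseval's identity bounds `Λ` by a Fejér average of the periodogram of `f` around `k`
(`le_sum_fejerWeight`). As `p / N` stays away from zero, all but a small part of the Fejér weight
lies within a bounded distance `M` of `k` (`sum_fejerWeight_tail_le`).

The periodogram is expressed through the Hartley coefficients of `f`, which are i.i.d. standard
normal because the Hartley transform is orthogonal (`iIndepFun_hartley`). A block of at most
`4 M + 2` coefficients is therefore entirely small with probability bounded below, and `K` disjoint blocks
fit into `ZMod N` when `N` is large. Averaging the `K` bounds with the normalized indicators of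
small blocks, Chebyshev's inequality (enough blocks are small) and Markov's inequality (the weight
outside of a block hits coefficients independent of it) show that `Λ` tends to zero in probability
(`measureReal_ge_le_of_blocks`, `exists_measureReal_ge_le`).

Finally `Λ` is at most a constant times the mean of the squares of `f`, whose moments are bounded
by Jensen's inequality (`rpow_moment_le`), so convergence in probability upgrades to convergence of
the `κ`-th moments (`integral_rpow_le_of_tail`).
-/

/-! ### The smallest eigenvalue as a Rayleigh quotient -/

theorem sampleCov_isHermitian {p n : ℕ} (X : Matrix (Fin p) (Fin n) ℝ) :
    (sampleCov X).IsHermitian := by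
  unfold sampleCov
  rw [Matrix.IsHermitian, Matrix.conjTranspose_eq_transpose_of_trivial]
  simp [Matrix.transpose_mul]

theorem dotProduct_sampleCov_mulVec {p n : ℕ} (X : Matrix (Fin p) (Fin n) ℝ) (u : Fin p → ℝ) :
    u ⬝ᵥ (sampleCov X).mulVec u = 1 / (n : ℝ) * ∑ j, (∑ i, u i * X i j) ^ 2 := by
  have h : u ⬝ᵥ (X * X.transpose).mulVec u = Matrix.vecMul u X ⬝ᵥ Matrix.vecMul u X := by
    rw [← Matrix.mulVec_mulVec, Matrix.dotProduct_mulVec, Matrix.mulVec_transpose]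
  rw [sampleCov, Matrix.smul_mulVec, dotProduct_smul, h, smul_eq_mul]
  simp [dotProduct, Matrix.vecMul, sq]

theorem le_smallestEigenvalue_iff {p n : ℕ} (hp : 0 < p) (X : Matrix (Fin p) (Fin n) ℝ) (t : ℝ) :
    t ≤ smallestEigenvalue (sampleCov X) ↔
      ∀ u : Fin p → ℝ, t * ∑ i, u i ^ 2 ≤ 1 / (n : ℝ) * ∑ j, (∑ i, u i * X i j) ^ 2 := by
  have hA := sampleCov_isHermitian X
  have hl := isLeast_smallestEigenvalue hp X
  have hB : (sampleCov X - algebraMap ℝ _ t).IsHermitian := by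
    refine hA.sub ?_
    rw [Matrix.algebraMap_eq_diagonal]
    exact Matrix.isHermitian_diagonal _
  have h1 : t ≤ smallestEigenvalue (sampleCov X) ↔ (sampleCov X - algebraMap ℝ _ t).PosSemidef := by
    rw [Matrix.posSemidef_iff_isHermitian_and_spectrum_nonneg, and_iff_right hB,
      ← spectrum.sub_singleton_eq]
    constructor
    · rintro h _ ⟨a, ha, b, rfl, rfl⟩
      exact sub_nonneg.2 (h.trans (hl.2 ha))
    · intro h
      exact sub_nonneg.1 (h ⟨_, hl.1, _, rfl, rfl⟩)
  rw [h1, Matrix.posSemidef_iff_dotProduct_mulVec, and_iff_right hB]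
  refine forall_congr' fun u => ?_
  rw [Matrix.sub_mulVec, dotProduct_sub, star_trivial, dotProduct_sampleCov_mulVec, sub_nonneg,
    Algebra.algebraMap_eq_smul_one, Matrix.smul_mulVec, Matrix.one_mulVec, dotProduct_smul,
    smul_eq_mul]
  simp [dotProduct, sq]

theorem smallestEigenvalue_sampleCov_nonneg {p n : ℕ} (X : Matrix (Fin p) (Fin n) ℝ) :
    0 ≤ smallestEigenvalue (sampleCov X) := by
  rcases Nat.eq_zero_or_pos p with rfl | hp
  · simp [smallestEigenvalue, spectrum.of_subsingleton]
  · rw [le_smallestEigenvalue_iff hp]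
    intro u
    rw [zero_mul]
    positivity

theorem smallestEigenvalue_sampleCov_mul_le {p n : ℕ} (hp : 0 < p) (X : Matrix (Fin p) (Fin n) ℝ)
    (u : Fin p → ℝ) :
    smallestEigenvalue (sampleCov X) * ∑ i, u i ^ 2
      ≤ 1 / (n : ℝ) * ∑ j, (∑ i, u i * X i j) ^ 2 :=
  (le_smallestEigenvalue_iff hp X _).1 le_rfl u

/-- The superlevel sets of `y ↦ λ_min (S (X y))` are intersections of the closed conditions given
by the Rayleigh quotients, so no continuity of eigenvalues is needed. -/
theorem measurable_smallestEigenvalue_sampleCov {p n : ℕ}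
    {X : (ℤ → ℝ) → Matrix (Fin p) (Fin n) ℝ} (hX : ∀ i j, Continuous fun y => X y i j) :
    Measurable fun y => smallestEigenvalue (sampleCov (X y)) := by
  rcases Nat.eq_zero_or_pos p with rfl | hp
  · simp [smallestEigenvalue, spectrum.of_subsingleton]
  · refine measurable_of_Ici fun t => IsClosed.measurableSet ?_
    have : (fun y => smallestEigenvalue (sampleCov (X y))) ⁻¹' Set.Ici t
        = ⋂ u : Fin p → ℝ, {y | t * ∑ i, u i ^ 2
            ≤ 1 / (n : ℝ) * ∑ j, (∑ i, u i * X y i j) ^ 2} := by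
      ext y
      simp only [Set.mem_preimage, Set.mem_Ici, Set.mem_iInter, Set.mem_ofPred_eq]
      exact le_smallestEigenvalue_iff hp _ t
    rw [this]
    exact isClosed_iInter fun u => isClosed_le (by fun_prop) (by fun_prop)

/-! ### Fourier analysis of circulant quadratic forms -/

/-- The squared norm of the circular convolution of `f` with the vector `u`, which is supported on
`0, …, p - 1`; up to normalization, the quadratic form of the sample covariance matrix of the
circulant matrix built from `f`. -/
noncomputable def convEnergy {N p : ℕ} [NeZero N] (f : ZMod N → ℝ) (u : Fin p → ℝ) : ℝ :=
  ∑ z : ZMod N, (∑ i : Fin p, u i * f (z - (i : ℕ))) ^ 2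

/-- The discrete Hartley transform with kernel `cos + sin`. Unlike the Fourier transform it is a
real orthogonal map. -/
noncomputable def hartley {N : ℕ} [NeZero N] (f : ZMod N → ℝ) (l : ZMod N) : ℝ :=
  (1 / √(N : ℝ)) *
    ∑ z, f z * ((ZMod.stdAddChar (l * z)).re + (ZMod.stdAddChar (l * z)).im)

/-- The Fejér weight of `ZMod N`: the normalized squared modulus of the Dirichlet kernel of
length `p`. -/
noncomputable def fejerWeight {N : ℕ} [NeZero N] (p : ℕ) (d : ZMod N) : ℝ :=
  ‖∑ i ∈ Finset.range p, ZMod.stdAddChar ((i : ZMod N) * d)‖ ^ 2 / (N * p)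

theorem sum_stdAddChar_mul {N : ℕ} [NeZero N] (d : ZMod N) :
    ∑ z : ZMod N, ZMod.stdAddChar (d * z) = if d = 0 then (N : ℂ) else 0 := by
  have h := AddChar.sum_mulShift d (ZMod.isPrimitive_stdAddChar N)
  simp_rw [mul_comm d]
  rw [h]
  split_ifs <;> simp [ZMod.card]

theorem sum_norm_sq_dft {N : ℕ} [NeZero N] (Φ : ZMod N → ℂ) :
    ∑ k, ‖ZMod.dft Φ k‖ ^ 2 = N * ∑ z, ‖Φ z‖ ^ 2 := by
  have h : ((∑ k, ‖ZMod.dft Φ k‖ ^ 2 : ℝ) : ℂ) = ((N * ∑ z, ‖Φ z‖ ^ 2 : ℝ) : ℂ) := by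
    push_cast
    simp_rw [← Complex.mul_conj', ZMod.dft_apply, map_sum, smul_eq_mul, map_mul,
      ← AddChar.map_neg_eq_conj, Finset.sum_mul_sum, neg_neg]
    rw [Finset.sum_comm]
    rw [Finset.mul_sum]
    refine Finset.sum_congr rfl fun a _ => ?_
    rw [Finset.sum_comm]
    have : ∀ b : ZMod N, ∑ k, ZMod.stdAddChar (-(a * k)) * Φ a *
        (ZMod.stdAddChar (b * k) * (starRingEnd ℂ) (Φ b))
        = Φ a * (starRingEnd ℂ) (Φ b) * if b - a = 0 then (N : ℂ) else 0 := by
      intro b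
      rw [← sum_stdAddChar_mul, Finset.mul_sum]
      refine Finset.sum_congr rfl fun k _ => ?_
      rw [sub_mul, sub_eq_neg_add, AddChar.map_add_eq_mul]
      ring
    simp_rw [this, sub_eq_zero]
    simp
    ring
  exact_mod_cast h

theorem dft_conv {N p : ℕ} [NeZero N] (v : Fin p → ℂ) (f : ZMod N → ℂ) (l : ZMod N) :
    ZMod.dft (fun z : ZMod N => ∑ i : Fin p, v i * f (z - ((i : ℕ) : ZMod N))) l
      = (∑ i : Fin p, v i * ZMod.stdAddChar (-(((i : ℕ) : ZMod N) * l))) * ZMod.dft f l := by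
  simp_rw [ZMod.dft_apply, smul_eq_mul]
  rw [Finset.sum_mul_sum]
  simp_rw [Finset.mul_sum]
  rw [Finset.sum_comm]
  refine Finset.sum_congr rfl fun i _ => ?_
  rw [← Equiv.sum_comp (Equiv.addRight ((i : ℕ) : ZMod N))]
  refine Finset.sum_congr rfl fun z _ => ?_
  simp only [Equiv.coe_addRight, add_sub_cancel_right]
  rw [add_mul, neg_add, AddChar.map_add_eq_mul]
  ring

theorem norm_sq_dft_eq_hartley {N : ℕ} [NeZero N] (f : ZMod N → ℝ) (l : ZMod N) :
    ‖ZMod.dft (fun z => (f z : ℂ)) l‖ ^ 2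
      = N * ((hartley f l ^ 2 + hartley f (-l) ^ 2) / 2) := by
  have hN : (0 : ℝ) < N := by exact_mod_cast NeZero.pos N
  have hs : (√(N : ℝ)) ^ 2 = N := Real.sq_sqrt hN.le
  have hs0 : √(N : ℝ) ≠ 0 := by positivity
  set a := ∑ z, f z * (ZMod.stdAddChar (l * z)).re with ha
  set b := ∑ z, f z * (ZMod.stdAddChar (l * z)).im with hb
  have h1 : hartley f l = (1 / √(N : ℝ)) * (a + b) := by
    simp [hartley, ha, hb, mul_add, Finset.sum_add_distrib]
  have h2 : hartley f (-l) = (1 / √(N : ℝ)) * (a - b) := by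
    simp [hartley, ha, hb, mul_add, Finset.sum_add_distrib, neg_mul, AddChar.map_neg_eq_conj,
      sub_eq_add_neg]
  have h3 : ZMod.dft (fun z => (f z : ℂ)) l = ⟨a, -b⟩ := by
    rw [ZMod.dft_apply]
    apply Complex.ext
    · simp [ha, AddChar.map_neg_eq_conj, mul_comm]
    · simp [hb, AddChar.map_neg_eq_conj, mul_comm]
  rw [h3, h1, h2, Complex.sq_norm, Complex.normSq_mk, mul_pow, mul_pow, div_pow, hs]
  field_simp
  ring

theorem sum_cas_mul_cas {N : ℕ} [NeZero N] (l k : ZMod N) :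
    ∑ z, ((ZMod.stdAddChar (l * z)).re + (ZMod.stdAddChar (l * z)).im) *
      ((ZMod.stdAddChar (k * z)).re + (ZMod.stdAddChar (k * z)).im)
      = if l = k then (N : ℝ) else 0 := by
  have h : ∀ z : ZMod N, ((ZMod.stdAddChar (l * z)).re + (ZMod.stdAddChar (l * z)).im) *
      ((ZMod.stdAddChar (k * z)).re + (ZMod.stdAddChar (k * z)).im)
      = (ZMod.stdAddChar ((l - k) * z)).re + (ZMod.stdAddChar ((l + k) * z)).im := by
    intro z
    rw [sub_mul, add_mul l k z, sub_eq_add_neg, AddChar.map_add_eq_mul, AddChar.map_add_eq_mul,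
      AddChar.map_neg_eq_conj]
    simp
    ring
  simp_rw [h]
  rw [Finset.sum_add_distrib, ← Complex.re_sum, ← Complex.im_sum, sum_stdAddChar_mul,
    sum_stdAddChar_mul]
  simp only [sub_eq_zero]
  split_ifs <;> simp

/-- Testing a lower bound for the quadratic form against the modes of frequency `k` (the real and
imaginary parts of a character, truncated to `0, …, p - 1`) bounds it by a Fejér average of the
periodogram around `k`. -/
theorem le_sum_fejerWeight {N p : ℕ} [NeZero N] (hp : 0 < p) (f : ZMod N → ℝ) {a C : ℝ}
    (h : ∀ u : Fin p → ℝ, a * ∑ i, u i ^ 2 ≤ C / N * convEnergy f u) (k : ZMod N) :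
    a ≤ C * ∑ l, fejerWeight p (k - l) * ((hartley f l ^ 2 + hartley f (-l) ^ 2) / 2) := by
  have hN : (0 : ℝ) < N := by exact_mod_cast NeZero.pos N
  have hp' : (0 : ℝ) < p := by exact_mod_cast hp
  let v : Fin p → ℂ := fun i => ZMod.stdAddChar (k * ((i : ℕ) : ZMod N))
  have h1 := add_le_add (h fun i => (v i).re) (h fun i => (v i).im)
  have hv : ∑ i, (v i).re ^ 2 + ∑ i, (v i).im ^ 2 = p := by
    rw [← Finset.sum_add_distrib]
    have : ∀ i, (v i).re ^ 2 + (v i).im ^ 2 = 1 := by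
      intro i
      have := AddChar.norm_apply ZMod.stdAddChar (k * ((i : ℕ) : ZMod N))
      have h2 := Complex.sq_norm (v i)
      rw [Complex.normSq_apply, this] at h2
      linarith
    simp [this]
  have hE : convEnergy f (fun i => (v i).re) + convEnergy f (fun i => (v i).im)
      = ∑ z, ‖∑ i : Fin p, v i * (f (z - (i : ℕ)) : ℂ)‖ ^ 2 := by
    rw [convEnergy, convEnergy, ← Finset.sum_add_distrib]
    refine Finset.sum_congr rfl fun z _ => ?_
    rw [Complex.sq_norm, Complex.normSq_apply, Complex.re_sum, Complex.im_sum]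
    simp [sq]
  have hP := sum_norm_sq_dft fun z : ZMod N => ∑ i : Fin p, v i * (f (z - (i : ℕ)) : ℂ)
  have hW : ∀ l, ‖ZMod.dft (fun z : ZMod N => ∑ i : Fin p, v i * (f (z - (i : ℕ)) : ℂ)) l‖ ^ 2
      = N * N * p * (fejerWeight p (k - l) *
        ((hartley f l ^ 2 + hartley f (-l) ^ 2) / 2)) := by
    intro l
    rw [dft_conv v (fun z => (f z : ℂ)) l, norm_mul, mul_pow, norm_sq_dft_eq_hartley, fejerWeight,
      ← Fin.sum_univ_eq_sum_range (fun i => ZMod.stdAddChar ((i : ZMod N) * (k - l)))]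
    have : ∀ i : Fin p, v i * ZMod.stdAddChar (-(((i : ℕ) : ZMod N) * l))
        = ZMod.stdAddChar (((i : ℕ) : ZMod N) * (k - l)) := by
      intro i
      rw [← AddChar.map_add_eq_mul]
      congr 1
      ring
    simp_rw [this]
    field_simp
  simp_rw [hW] at hP
  rw [← Finset.mul_sum, ← hE] at hP
  set S := ∑ l, fejerWeight p (k - l) * ((hartley f l ^ 2 + hartley f (-l) ^ 2) / 2)
  have hP' : convEnergy f (fun i => (v i).re) + convEnergy f (fun i => (v i).im) = N * p * S := by
    apply mul_left_cancel₀ hN.ne'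
    rw [← hP]
    ring
  rw [← mul_add, ← mul_add, hv, hP'] at h1
  have h2 : C / N * (N * p * S) = (C * S) * p := by
    field_simp
  rw [h2] at h1
  exact le_of_mul_le_mul_right h1 hp'

/-! ### Decay of the Fejér weights -/

theorem fejerWeight_nonneg {N : ℕ} [NeZero N] (p : ℕ) (d : ZMod N) : 0 ≤ fejerWeight p d := by
  unfold fejerWeight; positivity

theorem fejerWeight_le_one {N p : ℕ} [NeZero N] (hp : 0 < p) (hpN : p ≤ N) (d : ZMod N) :
    fejerWeight p d ≤ 1 := by
  have hN : (0 : ℝ) < N := by exact_mod_cast NeZero.pos N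
  have hp' : (0 : ℝ) < p := by exact_mod_cast hp
  have hpN' : (p : ℝ) ≤ N := by exact_mod_cast hpN
  rw [fejerWeight, div_le_one (by positivity)]
  have h : ‖∑ i ∈ Finset.range p, ZMod.stdAddChar ((i : ZMod N) * d)‖ ≤ p := by
    refine (norm_sum_le _ _).trans ?_
    simp
  calc _ ≤ (p : ℝ) ^ 2 := by gcongr
    _ ≤ N * p := by nlinarith

theorem norm_stdAddChar_sub_one_ge {N : ℕ} [NeZero N] (d : ZMod N) :
    4 * |(d.valMinAbs : ℝ)| / N ≤ ‖ZMod.stdAddChar d - 1‖ := by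
  have hN : (0 : ℝ) < N := by exact_mod_cast NeZero.pos N
  have hd : ZMod.stdAddChar d
      = Complex.exp (Complex.I * ((2 * Real.pi * d.valMinAbs / N : ℝ) : ℂ)) := by
    conv_lhs => rw [← ZMod.coe_valMinAbs d]
    rw [ZMod.stdAddChar_coe]
    congr 1
    push_cast
    ring
  have hmem := ZMod.valMinAbs_mem_Ioc d
  have habs : |(d.valMinAbs : ℝ)| * 2 ≤ N := by
    have : |d.valMinAbs| * 2 ≤ N := by
      rcases abs_cases d.valMinAbs with h | h <;> have := hmem.1 <;> have := hmem.2 <;> omega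
    exact_mod_cast this
  rw [hd, Complex.norm_exp_I_mul_ofReal_sub_one, norm_mul, Real.norm_eq_abs, Real.norm_eq_abs]
  have h1 := Real.mul_abs_le_abs_sin (x := 2 * Real.pi * d.valMinAbs / N / 2) (by
    rw [abs_div, abs_div, abs_mul, abs_mul, abs_of_pos Real.pi_pos, abs_of_pos hN]
    rw [abs_two]
    have := Real.pi_pos
    rw [div_div, div_le_div_iff₀ (by positivity) (by positivity)]
    nlinarith)
  have h2 : 2 / Real.pi * |2 * Real.pi * d.valMinAbs / N / 2| = 2 * |(d.valMinAbs : ℝ)| / N := by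
    rw [abs_div, abs_div, abs_mul, abs_mul, abs_of_pos Real.pi_pos, abs_of_pos hN, abs_two]
    have := Real.pi_pos
    field_simp
  rw [h2] at h1
  rw [abs_two]
  calc _ = 2 * (2 * |(d.valMinAbs : ℝ)| / N) := by ring
    _ ≤ _ := by gcongr

theorem fejerWeight_le {N p : ℕ} [NeZero N] (hp : 0 < p) {d : ZMod N} (hd : d ≠ 0) :
    fejerWeight p d ≤ N / (4 * p) * ((d.valMinAbs : ℝ) ^ 2)⁻¹ := by
  have hN : (0 : ℝ) < N := by exact_mod_cast NeZero.pos N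
  have hp' : (0 : ℝ) < p := by exact_mod_cast hp
  have hm : 0 < |(d.valMinAbs : ℝ)| := by
    rw [abs_pos]
    exact_mod_cast (ZMod.valMinAbs_eq_zero d).not.2 hd
  have hlow := norm_stdAddChar_sub_one_ge d
  have hpos : 0 < ‖ZMod.stdAddChar d - 1‖ := lt_of_lt_of_le (by positivity) hlow
  have h1 : ‖∑ i ∈ Finset.range p, ZMod.stdAddChar ((i : ZMod N) * d)‖
      ≤ N / (2 * |(d.valMinAbs : ℝ)|) := by
    have hg : ∑ i ∈ Finset.range p, ZMod.stdAddChar ((i : ZMod N) * d)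
        = (ZMod.stdAddChar d ^ p - 1) / (ZMod.stdAddChar d - 1) := by
      rw [← geom_sum_eq (sub_ne_zero.1 (norm_pos_iff.1 hpos))]
      refine Finset.sum_congr rfl fun i _ => ?_
      rw [← nsmul_eq_mul, AddChar.map_nsmul_eq_pow]
    rw [hg, norm_div, div_le_iff₀ hpos]
    calc ‖ZMod.stdAddChar d ^ p - 1‖ ≤ ‖ZMod.stdAddChar d ^ p‖ + ‖(1 : ℂ)‖ := norm_sub_le _ _
      _ = 2 := by rw [norm_pow, AddChar.norm_apply]; norm_num
      _ = N / (2 * |(d.valMinAbs : ℝ)|) * (4 * |(d.valMinAbs : ℝ)| / N) := by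
          field_simp; norm_num
      _ ≤ _ := by gcongr
  rw [fejerWeight]
  calc _ ≤ (N / (2 * |(d.valMinAbs : ℝ)|)) ^ 2 / (N * p) := by gcongr
    _ = _ := by
      rw [div_pow, mul_pow, sq_abs]
      have : (d.valMinAbs : ℝ) ^ 2 ≠ 0 := by rw [← sq_abs]; positivity
      field_simp
      norm_num

theorem sum_inv_sq_valMinAbs_le {N : ℕ} [NeZero N] {M : ℕ} (hM : 0 < M) :
    ∑ d : ZMod N with (M : ℤ) < |d.valMinAbs|, ((d.valMinAbs : ℝ) ^ 2)⁻¹ ≤ 2 / M := by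
  have hM' : (0 : ℝ) < M := by exact_mod_cast hM
  set s : Finset (ZMod N) := Finset.univ.filter fun d => (M : ℤ) < |d.valMinAbs|
  let g : ZMod N → Bool × ℕ := fun d => (decide (0 ≤ d.valMinAbs), d.valMinAbs.natAbs)
  have hg : Set.InjOn g s := by
    intro a _ b _ hab
    simp only [g, Prod.mk.injEq, decide_eq_decide] at hab
    apply ZMod.injective_valMinAbs
    omega
  have hmap : ∀ d ∈ s, g d ∈ Finset.univ ×ˢ Finset.Ioc M (M + N) := by
    intro d hd
    simp only [s, Finset.mem_filter, Finset.mem_univ, true_and] at hd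
    have := ZMod.valMinAbs_mem_Ioc d
    simp only [g, Finset.mem_product, Finset.mem_univ, Finset.mem_Ioc, true_and]
    have h1 := this.1
    have h2 := this.2
    rcases abs_cases d.valMinAbs with h | h <;> omega
  calc ∑ d ∈ s, ((d.valMinAbs : ℝ) ^ 2)⁻¹ = ∑ d ∈ s, ((((g d).2 : ℕ) : ℝ) ^ 2)⁻¹ := by
        refine Finset.sum_congr rfl fun d _ => ?_
        simp [g]
    _ = ∑ e ∈ s.image g, ((e.2 : ℝ) ^ 2)⁻¹ := (Finset.sum_image (f := fun e : Bool × ℕ =>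
        ((e.2 : ℝ) ^ 2)⁻¹) hg).symm
    _ ≤ ∑ e ∈ (Finset.univ : Finset Bool) ×ˢ Finset.Ioc M (M + N), ((e.2 : ℝ) ^ 2)⁻¹ := by
        refine Finset.sum_le_sum_of_subset_of_nonneg ?_ fun _ _ _ => by positivity
        exact Finset.image_subset_iff.2 hmap
    _ = 2 * ∑ m ∈ Finset.Ioc M (M + N), ((m : ℝ) ^ 2)⁻¹ := by
        rw [Finset.sum_product]; simp
    _ ≤ 2 * ((M : ℝ)⁻¹ - ((M + N : ℕ) : ℝ)⁻¹) := by
        gcongr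
        exact sum_Ioc_inv_sq_le_sub hM.ne' (by omega)
    _ ≤ 2 / M := by
        rw [div_eq_mul_inv]
        have : (0 : ℝ) ≤ ((M + N : ℕ) : ℝ)⁻¹ := by positivity
        linarith

theorem sum_fejerWeight_tail_le {N p M : ℕ} [NeZero N] (hp : 0 < p) (hM : 0 < M) (k : ZMod N)
    {B : Finset (ZMod N)} (hB : ∀ l ∉ B, (M : ℤ) < |(k - l).valMinAbs|) :
    ∑ l ∈ Bᶜ, fejerWeight p (k - l) ≤ N / (2 * p * M) := by
  have hp' : (0 : ℝ) < p := by exact_mod_cast hp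
  have hM' : (0 : ℝ) < M := by exact_mod_cast hM
  calc ∑ l ∈ Bᶜ, fejerWeight p (k - l)
      = ∑ d ∈ Bᶜ.image (fun l => k - l), fejerWeight p d :=
        (Finset.sum_image fun _ _ _ _ h => sub_right_injective h).symm
    _ ≤ ∑ d : ZMod N with (M : ℤ) < |d.valMinAbs|, fejerWeight p d := by
        refine Finset.sum_le_sum_of_subset_of_nonneg ?_ fun _ _ _ => fejerWeight_nonneg _ _
        intro d hd
        obtain ⟨l, hl, rfl⟩ := Finset.mem_image.1 hd
        simpa using hB l (Finset.mem_compl.1 hl)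
    _ ≤ ∑ d : ZMod N with (M : ℤ) < |d.valMinAbs|, N / (4 * p) * ((d.valMinAbs : ℝ) ^ 2)⁻¹ := by
        refine Finset.sum_le_sum fun d hd => fejerWeight_le hp ?_
        rintro rfl
        simp at hd
        omega
    _ ≤ N / (4 * p) * (2 / M) := by
        rw [← Finset.mul_sum]
        gcongr
        exact sum_inv_sq_valMinAbs_le hM
    _ = _ := by field_simp; norm_num

/-! ### Symmetric blocks of frequencies -/

/-- The residues within distance `M` of `c` or of `-c`. Both are needed because the periodogram at
`l` involves the Hartley coefficients at `l` and at `-l`. -/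
def freqBlock (N M : ℕ) [NeZero N] (c : ZMod N) : Finset (ZMod N) :=
  Finset.univ.filter fun l => |(c - l).valMinAbs| ≤ M ∨ |(c + l).valMinAbs| ≤ M

theorem neg_mem_freqBlock {N M : ℕ} [NeZero N] {c l : ZMod N} :
    -l ∈ freqBlock N M c ↔ l ∈ freqBlock N M c := by
  simp [freqBlock, or_comm, ← sub_eq_add_neg]

theorem lt_abs_valMinAbs_of_notMem_freqBlock {N M : ℕ} [NeZero N] {c l : ZMod N}
    (h : l ∉ freqBlock N M c) : (M : ℤ) < |(c - l).valMinAbs| := by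
  simp only [freqBlock, Finset.mem_filter, Finset.mem_univ, true_and, not_or, not_le] at h
  exact h.1

theorem card_freqBlock_le (N M : ℕ) [NeZero N] (c : ZMod N) :
    (freqBlock N M c).card ≤ 2 * (2 * M + 1) := by
  let I := Finset.Icc (-(M : ℤ)) M
  have hI : I.card = 2 * M + 1 := by simp [I]; omega
  have hsub : freqBlock N M c
      ⊆ I.image (fun a : ℤ => c - (a : ZMod N)) ∪ I.image (fun a : ℤ => (a : ZMod N) - c) := by
    intro l hl
    simp only [freqBlock, Finset.mem_filter, Finset.mem_univ, true_and] at hl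
    rw [Finset.mem_union, Finset.mem_image, Finset.mem_image]
    refine hl.imp (fun h => ⟨_, Finset.mem_Icc.2 (abs_le.1 h), ?_⟩)
      (fun h => ⟨_, Finset.mem_Icc.2 (abs_le.1 h), ?_⟩)
    · simp
    · simp
  calc _ ≤ _ := Finset.card_le_card hsub
    _ ≤ _ := Finset.card_union_le _ _
    _ ≤ I.card + I.card := add_le_add Finset.card_image_le Finset.card_image_le
    _ = _ := by rw [hI]; ring

theorem disjoint_freqBlock {N M a b : ℕ} [NeZero N] (ha : M < a) (hab : a + 2 * M < b)
    (hb : 2 * (b + M) < N) : Disjoint (freqBlock N M (a : ZMod N)) (freqBlock N M (b : ZMod N)) := by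
  -- A common element would give a nonzero integer of absolute value below `N` and divisible by `N`.
  have key : ∀ e : ℤ, (e : ZMod N) = 0 → |e| < N → e ≠ 0 → False := fun e h1 h2 h3 =>
    h3 (Int.eq_zero_of_abs_lt_dvd ((ZMod.intCast_zmod_eq_zero_iff_dvd e N).1 h1) h2)
  rw [Finset.disjoint_left]
  intro l h1 h2
  simp only [freqBlock, Finset.mem_filter, Finset.mem_univ, true_and, abs_le] at h1 h2
  rcases h1 with h1 | h1 <;> rcases h2 with h2 | h2
  · refine key ((b - ((b : ZMod N) - l).valMinAbs) - (a - ((a : ZMod N) - l).valMinAbs)) ?_ ?_ ?_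
    · push_cast [ZMod.coe_valMinAbs]; ring
    · rw [abs_lt]; omega
    · omega
  · refine key ((b - ((b : ZMod N) + l).valMinAbs) + (a - ((a : ZMod N) - l).valMinAbs)) ?_ ?_ ?_
    · push_cast [ZMod.coe_valMinAbs]; ring
    · rw [abs_lt]; omega
    · omega
  · refine key ((b - ((b : ZMod N) - l).valMinAbs) + (a - ((a : ZMod N) + l).valMinAbs)) ?_ ?_ ?_
    · push_cast [ZMod.coe_valMinAbs]; ring
    · rw [abs_lt]; omega
    · omega
  · refine key ((b - ((b : ZMod N) + l).valMinAbs) - (a - ((a : ZMod N) + l).valMinAbs)) ?_ ?_ ?_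
    · push_cast [ZMod.coe_valMinAbs]; ring
    · rw [abs_lt]; omega
    · omega

/-! ### Independence of the Hartley coefficients of Gaussian noise -/

section Hartley

variable {Ω : Type*} [MeasurableSpace Ω] {P : Measure Ω} {N : ℕ} [NeZero N]
  {f : ZMod N → Ω → ℝ}

theorem hartley_eq_sum_mul (y : ZMod N → ℝ) (l : ZMod N) :
    hartley y l = ∑ z, (1 / √(N : ℝ) *
      ((ZMod.stdAddChar (l * z)).re + (ZMod.stdAddChar (l * z)).im)) * y z := by
  rw [hartley, Finset.mul_sum]
  exact Finset.sum_congr rfl fun z _ => by ring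

theorem hasGaussianLaw_hartley [IsProbabilityMeasure P] (hf : iIndepFun f P)
    (hlaw : ∀ z, HasLaw (f z) (gaussianReal 0 1) P) :
    HasGaussianLaw (fun ω l => hartley (fun z => f z ω) l) P := by
  have h := iIndepFun.hasGaussianLaw (fun z => (hlaw z).hasGaussianLaw) hf
  let T : (ZMod N → ℝ) →L[ℝ] (ZMod N → ℝ) := ContinuousLinearMap.pi fun l =>
    ∑ z, (1 / √(N : ℝ) * ((ZMod.stdAddChar (l * z)).re + (ZMod.stdAddChar (l * z)).im)) •
      ContinuousLinearMap.proj (R := ℝ) (φ := fun _ : ZMod N => ℝ) z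
  have hT : (fun ω l => hartley (fun z => f z ω) l) = T ∘ fun ω z => f z ω := by
    ext ω l
    simp [T, hartley_eq_sum_mul]
  rw [hT]
  exact h.map T

theorem covariance_hartley [IsProbabilityMeasure P] (hf : iIndepFun f P)
    (hlaw : ∀ z, HasLaw (f z) (gaussianReal 0 1) P) (l k : ZMod N) :
    cov[fun ω => hartley (fun z => f z ω) l, fun ω => hartley (fun z => f z ω) k; P]
      = if l = k then 1 else 0 := by
  have hN : (0 : ℝ) < N := by exact_mod_cast NeZero.pos N
  have hs : √(N : ℝ) * √(N : ℝ) = N := Real.mul_self_sqrt hN.le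
  have hL2 : ∀ z, MemLp (f z) 2 P := fun z => (hlaw z).hasGaussianLaw.memLp_two
  have hc : ∀ z w, cov[f z, f w; P] = if z = w then 1 else 0 := by
    intro z w
    split_ifs with h
    · rw [h, covariance_self (hlaw w).aemeasurable, (hlaw w).variance_eq, variance_id_gaussianReal]
      simp
    · exact (hf.indepFun h).covariance_eq_zero (hL2 z) (hL2 w)
  simp_rw [hartley_eq_sum_mul]
  rw [covariance_fun_sum_fun_sum (fun z => (hL2 z).const_mul _) (fun z => (hL2 z).const_mul _)]
  simp_rw [covariance_const_mul_left, covariance_const_mul_right, hc]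
  simp only [mul_ite, mul_one, mul_zero, Finset.sum_ite_eq, Finset.mem_univ, if_true]
  have h := sum_cas_mul_cas l k
  calc _ = (1 / √(N : ℝ) * (1 / √(N : ℝ))) *
      ∑ z, ((ZMod.stdAddChar (l * z)).re + (ZMod.stdAddChar (l * z)).im) *
      ((ZMod.stdAddChar (k * z)).re + (ZMod.stdAddChar (k * z)).im) := by
        rw [Finset.mul_sum]
        exact Finset.sum_congr rfl fun z _ => by ring
    _ = _ := by
        rw [h, div_mul_div_comm, hs]
        split_ifs
        · field_simp
        · simp

theorem iIndepFun_hartley [IsProbabilityMeasure P] (hf : iIndepFun f P)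
    (hlaw : ∀ z, HasLaw (f z) (gaussianReal 0 1) P) :
    iIndepFun (fun l ω => hartley (fun z => f z ω) l) P :=
  (hasGaussianLaw_hartley hf hlaw).iIndepFun_of_covariance_eq_zero fun l k h => by
    rw [covariance_hartley hf hlaw, if_neg h]

theorem hasLaw_hartley [IsProbabilityMeasure P] (hf : iIndepFun f P)
    (hlaw : ∀ z, HasLaw (f z) (gaussianReal 0 1) P) (l : ZMod N) :
    HasLaw (fun ω => hartley (fun z => f z ω) l) (gaussianReal 0 1) P := by
  have hG := (hasGaussianLaw_hartley hf hlaw).eval l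
  refine ⟨hG.aemeasurable, ?_⟩
  rw [hG.map_eq_gaussianReal, ← covariance_self hG.aemeasurable, covariance_hartley hf hlaw]
  have : ∫ ω, hartley (fun z => f z ω) l ∂P = 0 := by
    simp_rw [hartley_eq_sum_mul]
    rw [integral_finsetSum _ fun z _ => (hlaw z).hasGaussianLaw.integrable.const_mul _]
    simp_rw [integral_const_mul, (hlaw _).integral_eq, integral_id_gaussianReal]
    simp
  simp [this]

theorem measurable_hartley (hm : ∀ z, Measurable (f z)) (l : ZMod N) :
    Measurable fun ω => hartley (fun z => f z ω) l := by
  simp_rw [hartley_eq_sum_mul]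
  fun_prop

end Hartley

/-! ### Moments of averages of squared Gaussians -/

section Moments

variable {Ω : Type*} [MeasurableSpace Ω] {P : Measure Ω}

theorem integrable_sq_rpow_gaussianReal {r : ℝ} (hr : 0 < r) :
    Integrable (fun x : ℝ => (x ^ 2) ^ r) (gaussianReal 0 1) := by
  have h := (memLp_id_gaussianReal' (μ := 0) (v := 1) (ENNReal.ofReal (2 * r))
    ENNReal.ofReal_ne_top).integrable_norm_rpow (by simpa using hr) ENNReal.ofReal_ne_top
  refine h.congr (Eventually.of_forall fun x => ?_)
  simp only [id, Real.norm_eq_abs]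
  rw [ENNReal.toReal_ofReal (by positivity), Real.rpow_mul (abs_nonneg x), Real.rpow_two, sq_abs]

theorem rpow_moment_le {ι : Type*} [Fintype ι] [Nonempty ι] {f : ι → Ω → ℝ}
    (hlaw : ∀ z, HasLaw (f z) (gaussianReal 0 1) P) {Λ : Ω → ℝ} (hΛm : Measurable Λ)
    (hΛ0 : ∀ ω, 0 ≤ Λ ω) {C : ℝ} (hC : 0 ≤ C)
    (hΛ : ∀ ω, Λ ω ≤ C * ∑ z, (Fintype.card ι : ℝ)⁻¹ * f z ω ^ 2) {r : ℝ} (hr : 1 ≤ r) :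
    Integrable (fun ω => Λ ω ^ r) P ∧
      ∫ ω, Λ ω ^ r ∂P ≤ C ^ r * ∫ x, (x ^ 2) ^ r ∂(gaussianReal 0 1) := by
  have hI := integrable_sq_rpow_gaussianReal (r := r) (by linarith)
  have hc : (Fintype.card ι : ℝ) ≠ 0 := by exact_mod_cast Fintype.card_ne_zero
  have hIz : ∀ z, Integrable (fun ω => (f z ω ^ 2) ^ r) P := fun z => by
    have h := hI
    rw [← (hlaw z).map_eq] at h
    exact h.comp_aemeasurable (hlaw z).aemeasurable
  have hEz : ∀ z, ∫ ω, (f z ω ^ 2) ^ r ∂P = ∫ x, (x ^ 2) ^ r ∂(gaussianReal 0 1) := fun z =>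
    (hlaw z).integral_comp hI.aestronglyMeasurable
  have hbound : ∀ ω, Λ ω ^ r ≤ C ^ r * ∑ z, (Fintype.card ι : ℝ)⁻¹ * (f z ω ^ 2) ^ r := fun ω => by
    calc Λ ω ^ r ≤ (C * ∑ z, (Fintype.card ι : ℝ)⁻¹ * f z ω ^ 2) ^ r :=
          Real.rpow_le_rpow (hΛ0 ω) (hΛ ω) (by linarith)
      _ = C ^ r * (∑ z, (Fintype.card ι : ℝ)⁻¹ * f z ω ^ 2) ^ r :=
          Real.mul_rpow hC (Finset.sum_nonneg fun _ _ => by positivity)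
      _ ≤ _ := by
          gcongr
          refine Real.rpow_arith_mean_le_arith_mean_rpow _ _ _ (fun _ _ => by positivity) ?_
            (fun _ _ => by positivity) hr
          simp [hc]
  have hB : Integrable (fun ω => C ^ r * ∑ z, (Fintype.card ι : ℝ)⁻¹ * (f z ω ^ 2) ^ r) P :=
    (integrable_finsetSum _ fun z _ => (hIz z).const_mul _).const_mul _
  have hint : Integrable (fun ω => Λ ω ^ r) P :=
    hB.mono' (hΛm.pow_const r).aestronglyMeasurable (Eventually.of_forall fun ω => by
      rw [Real.norm_of_nonneg (Real.rpow_nonneg (hΛ0 ω) r)]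
      exact hbound ω)
  refine ⟨hint, (integral_mono hint hB hbound).trans_eq ?_⟩
  rw [integral_const_mul, integral_finsetSum _ fun z _ => (hIz z).const_mul _]
  simp_rw [integral_const_mul, hEz]
  simp [hc]

/-- A small probability of `τ ≤ Λ` together with a bounded `2κ`-th moment makes the `κ`-th moment
small, uniformly. The auxiliary parameter `s` plays the role of the Cauchy–Schwarz inequality. -/
theorem integral_rpow_le_of_tail [IsProbabilityMeasure P] {Λ : Ω → ℝ} (hΛm : Measurable Λ)
    (hΛ0 : ∀ ω, 0 ≤ Λ ω) {κ τ s : ℝ} (hκ : 0 < κ) (hτ : 0 < τ) (hs : 0 < s)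
    (h1 : Integrable (fun ω => Λ ω ^ κ) P) (h2 : Integrable (fun ω => Λ ω ^ (2 * κ)) P) :
    ∫ ω, Λ ω ^ κ ∂P ≤ τ ^ κ + s * ∫ ω, Λ ω ^ (2 * κ) ∂P + s⁻¹ * P.real {ω | τ ≤ Λ ω} := by
  have hmeas : MeasurableSet {ω | τ ≤ Λ ω} := measurableSet_le measurable_const hΛm
  have hind : Integrable (Set.indicator {ω | τ ≤ Λ ω} fun _ => (1 : ℝ)) P :=
    (integrable_const 1).indicator hmeas
  have hb : ∀ ω, Λ ω ^ κ ≤ τ ^ κ + s * Λ ω ^ (2 * κ)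
      + s⁻¹ * Set.indicator {ω | τ ≤ Λ ω} (fun _ => (1 : ℝ)) ω := by
    intro ω
    have hsq : Λ ω ^ (2 * κ) = (Λ ω ^ κ) ^ 2 := by
      rw [mul_comm, Real.rpow_mul (hΛ0 ω), Real.rpow_two]
    have hτκ : 0 ≤ τ ^ κ := by positivity
    have hΛκ : 0 ≤ Λ ω ^ κ := Real.rpow_nonneg (hΛ0 ω) κ
    rw [hsq]
    by_cases h : τ ≤ Λ ω
    · rw [Set.indicator_of_mem (by exact h)]
      have : 0 ≤ s * (Λ ω ^ κ - s⁻¹ / 2) ^ 2 := by positivity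
      have hexp : s * (Λ ω ^ κ - s⁻¹ / 2) ^ 2
          = s * (Λ ω ^ κ) ^ 2 - Λ ω ^ κ + s⁻¹ / 4 := by
        field_simp; ring
      have : 0 < s⁻¹ := by positivity
      linarith
    · rw [Set.indicator_of_notMem (by exact h)]
      have : Λ ω ^ κ ≤ τ ^ κ := Real.rpow_le_rpow (hΛ0 ω) (not_le.1 h).le hκ.le
      have : 0 ≤ s * (Λ ω ^ κ) ^ 2 := by positivity
      linarith
  have hi1 : Integrable (fun ω => τ ^ κ + s * Λ ω ^ (2 * κ)) P :=
    (integrable_const _).add (h2.const_mul s)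
  refine (integral_mono h1 (hi1.add (hind.const_mul s⁻¹)) hb).trans_eq ?_
  simp only [Pi.add_apply]
  rw [integral_add hi1 (hind.const_mul _),
    integral_add (integrable_const _) (h2.const_mul s), integral_const_mul, integral_const_mul,
    integral_indicator hmeas]
  simp

end Moments

/-! ### Selecting a block of small coefficients -/

/-- The indicator of `x ^ 2 ≤ ε`, normalized to have mean one under the standard Gaussian law. -/
noncomputable def smallDensity (ε x : ℝ) : ℝ :=
  if x ^ 2 ≤ ε then ((gaussianReal 0 1).real {y | y ^ 2 ≤ ε})⁻¹ else 0

theorem measurableSet_sq_le (ε : ℝ) : MeasurableSet {y : ℝ | y ^ 2 ≤ ε} :=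
  measurableSet_le (by fun_prop) measurable_const

theorem gaussianReal_sq_le_pos {ε : ℝ} (hε : 0 < ε) :
    0 < (gaussianReal 0 1).real {y | y ^ 2 ≤ ε} := by
  rw [measureReal_def, ENNReal.toReal_pos_iff]
  refine ⟨pos_iff_ne_zero.2 fun h => ?_, measure_lt_top _ _⟩
  have h1 := gaussianReal_absolutelyContinuous' 0 one_ne_zero h
  have h2 : volume {y : ℝ | y ^ 2 < ε} = 0 :=
    measure_mono_null (fun y (hy : y ^ 2 < ε) => hy.le) h1
  have ho : IsOpen {y : ℝ | y ^ 2 < ε} := isOpen_lt (by fun_prop) continuous_const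
  exact (ho.measure_pos volume ⟨0, by simpa using hε⟩).ne' h2

theorem measurable_smallDensity (ε : ℝ) : Measurable (smallDensity ε) :=
  Measurable.ite (measurableSet_sq_le ε) measurable_const measurable_const

theorem smallDensity_nonneg (ε x : ℝ) : 0 ≤ smallDensity ε x := by
  unfold smallDensity; split_ifs <;> positivity

theorem smallDensity_le (ε x : ℝ) :
    smallDensity ε x ≤ ((gaussianReal 0 1).real {y | y ^ 2 ≤ ε})⁻¹ := by
  unfold smallDensity
  split_ifs
  · exact le_rfl
  · positivity

theorem integral_smallDensity {ε : ℝ} (hε : 0 < ε) :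
    ∫ x, smallDensity ε x ∂(gaussianReal 0 1) = 1 := by
  have h : smallDensity ε = Set.indicator {y | y ^ 2 ≤ ε}
      fun _ => ((gaussianReal 0 1).real {y | y ^ 2 ≤ ε})⁻¹ := by
    ext x; simp [smallDensity, Set.indicator]
  rw [h, integral_indicator (measurableSet_sq_le ε)]
  simp [(gaussianReal_sq_le_pos hε).ne']

section Blocks

variable {Ω ι : Type*} {g : ι → Ω → ℝ}

/-- The indicator that all coefficients in the block `B` are small, normalized to mean one. -/
noncomputable def blockDensity (ε : ℝ) (g : ι → Ω → ℝ) (B : Finset ι) (ω : Ω) : ℝ :=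
  ∏ l ∈ B, smallDensity ε (g l ω)

theorem blockDensity_nonneg (ε : ℝ) (B : Finset ι) (ω : Ω) : 0 ≤ blockDensity ε g B ω :=
  Finset.prod_nonneg fun _ _ => smallDensity_nonneg _ _

theorem blockDensity_mul_sq_le (ε : ℝ) {B : Finset ι} (ω : Ω) {l : ι} (hl : l ∈ B) :
    blockDensity ε g B ω * g l ω ^ 2 ≤ blockDensity ε g B ω * ε := by
  by_cases h : g l ω ^ 2 ≤ ε
  · exact mul_le_mul_of_nonneg_left h (blockDensity_nonneg _ _ _)
  · have : blockDensity ε g B ω = 0 := Finset.prod_eq_zero hl (by simp [smallDensity, h])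
    simp [this]

theorem blockDensity_le {ε : ℝ} (hε : 0 < ε) {B : Finset ι} {D : ℕ} (hB : B.card ≤ D) (ω : Ω) :
    blockDensity ε g B ω ≤ (((gaussianReal 0 1).real {y | y ^ 2 ≤ ε})⁻¹) ^ D :=
  calc _ ≤ ∏ _l ∈ B, ((gaussianReal 0 1).real {y | y ^ 2 ≤ ε})⁻¹ :=
        Finset.prod_le_prod (fun _ _ => smallDensity_nonneg _ _) fun _ _ => smallDensity_le _ _
    _ = (((gaussianReal 0 1).real {y | y ^ 2 ≤ ε})⁻¹) ^ B.card := Finset.prod_const _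
    _ ≤ _ := pow_le_pow_right₀
        ((one_le_inv₀ (gaussianReal_sq_le_pos hε)).2 measureReal_le_one) hB

variable [MeasurableSpace Ω] {P : Measure Ω}

theorem measurable_blockDensity (ε : ℝ) (hm : ∀ l, Measurable (g l)) (B : Finset ι) :
    Measurable (blockDensity ε g B) :=
  Finset.measurable_fun_prod _ fun l _ => (measurable_smallDensity ε).comp (hm l)

theorem integral_blockDensity {ε : ℝ} (hε : 0 < ε) (hg : iIndepFun g P)
    (hm : ∀ l, Measurable (g l)) (hlaw : ∀ l, HasLaw (g l) (gaussianReal 0 1) P)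
    (B : Finset ι) : ∫ ω, blockDensity ε g B ω ∂P = 1 := by
  have h1 : iIndepFun (fun (l : B) ω => smallDensity ε (g l ω)) P :=
    (hg.precomp (g := ((↑) : B → ι)) Subtype.val_injective).comp (fun _ => smallDensity ε)
      fun _ => measurable_smallDensity ε
  have h2 : ∀ ω, blockDensity ε g B ω = ∏ l : B, smallDensity ε (g l ω) := fun ω =>
    (Finset.prod_coe_sort B fun l => smallDensity ε (g l ω)).symm
  simp_rw [h2]
  rw [h1.integral_fun_prod_eq_prod_integral fun l =>
    ((measurable_smallDensity ε).comp (hm l)).aestronglyMeasurable]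
  refine Finset.prod_eq_one fun l _ => ?_
  rw [← integral_smallDensity hε]
  exact (hlaw l).integral_comp (measurable_smallDensity ε).aestronglyMeasurable

theorem indepFun_blockDensity (ε : ℝ) (hg : iIndepFun g P) (hm : ∀ l, Measurable (g l))
    {A B : Finset ι} (hAB : Disjoint A B) :
    IndepFun (blockDensity ε g A) (blockDensity ε g B) P := by
  have h := hg.indepFun_finset A B hAB hm
  have hφ : ∀ S : Finset ι, Measurable fun v : S → ℝ => ∏ l, smallDensity ε (v l) := fun S =>
    Finset.measurable_fun_prod _ fun l _ =>
      (measurable_smallDensity ε).comp (measurable_pi_apply l)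
  have h2 := h.comp (hφ A) (hφ B)
  have h3 : ∀ S : Finset ι, blockDensity ε g S
      = (fun v : S → ℝ => ∏ l, smallDensity ε (v l)) ∘ fun ω (l : S) => g l ω := fun S => by
    ext ω
    exact (Finset.prod_coe_sort S fun l => smallDensity ε (g l ω)).symm
  rw [h3 A, h3 B]
  exact h2

theorem indepFun_blockDensity_sq (ε : ℝ) (hg : iIndepFun g P) (hm : ∀ l, Measurable (g l))
    {B : Finset ι} {l : ι} (hl : l ∉ B) :
    IndepFun (blockDensity ε g B) (fun ω => g l ω ^ 2) P := by
  have h := hg.indepFun_finset B {l} (Finset.disjoint_singleton_right.2 hl) hm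
  have h2 := h.comp (φ := fun v : B → ℝ => ∏ l, smallDensity ε (v l))
    (ψ := fun v : ({l} : Finset ι) → ℝ => v ⟨l, Finset.mem_singleton_self l⟩ ^ 2)
    (Finset.measurable_fun_prod _ fun l _ =>
      (measurable_smallDensity ε).comp (measurable_pi_apply l))
    (by fun_prop)
  have h3 : blockDensity ε g B
      = (fun v : B → ℝ => ∏ l, smallDensity ε (v l)) ∘ fun ω (l : B) => g l ω := by
    ext ω
    exact (Finset.prod_coe_sort B fun l => smallDensity ε (g l ω)).symm
  rw [h3]
  exact h2

theorem integrable_sq_of_hasLaw {X : Ω → ℝ} (hX : HasLaw X (gaussianReal 0 1) P) :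
    Integrable (fun ω => X ω ^ 2) P :=
  hX.hasGaussianLaw.memLp_two.integrable_sq

theorem integral_sq_of_hasLaw [IsProbabilityMeasure P] {X : Ω → ℝ}
    (hX : HasLaw X (gaussianReal 0 1) P) : ∫ ω, X ω ^ 2 ∂P = 1 := by
  have h1 := hX.variance_eq
  have h0 : ∫ ω, X ω ∂P = 0 := by rw [hX.integral_eq, integral_id_gaussianReal]
  rw [variance_id_gaussianReal, variance_of_integral_eq_zero hX.aemeasurable h0] at h1
  simpa using h1

theorem integrable_blockDensity_mul [IsFiniteMeasure P] {ε : ℝ} (hε : 0 < ε)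
    (hm : ∀ l, Measurable (g l)) (B : Finset ι) {T : Ω → ℝ} (hT : Integrable T P) :
    Integrable (fun ω => blockDensity ε g B ω * T ω) P :=
  hT.bdd_mul (measurable_blockDensity ε hm B).aestronglyMeasurable
    (Eventually.of_forall fun ω => by
      rw [Real.norm_of_nonneg (blockDensity_nonneg _ _ _)]
      exact blockDensity_le hε le_rfl ω)

theorem integrable_blockDensity [IsFiniteMeasure P] {ε : ℝ} (hε : 0 < ε)
    (hm : ∀ l, Measurable (g l)) (B : Finset ι) : Integrable (blockDensity ε g B) P := by
  simpa using integrable_blockDensity_mul (P := P) hε hm B (integrable_const (1 : ℝ))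

theorem memLp_blockDensity [IsFiniteMeasure P] {ε : ℝ} (hε : 0 < ε)
    (hm : ∀ l, Measurable (g l)) (B : Finset ι) : MemLp (blockDensity ε g B) 2 P :=
  MemLp.of_bound (measurable_blockDensity ε hm B).aestronglyMeasurable _
    (Eventually.of_forall fun ω => by
      rw [Real.norm_of_nonneg (blockDensity_nonneg _ _ _)]
      exact blockDensity_le hε le_rfl ω)

theorem variance_blockDensity_le [IsProbabilityMeasure P] {ε : ℝ} (hε : 0 < ε)
    (hg : iIndepFun g P) (hm : ∀ l, Measurable (g l))
    (hlaw : ∀ l, HasLaw (g l) (gaussianReal 0 1) P) {B : Finset ι} {D : ℕ} (hB : B.card ≤ D) :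
    Var[blockDensity ε g B; P] ≤ (((gaussianReal 0 1).real {y | y ^ 2 ≤ ε})⁻¹) ^ D := by
  set R := (((gaussianReal 0 1).real {y | y ^ 2 ≤ ε})⁻¹) ^ D
  refine (variance_le_expectation_sq
    (measurable_blockDensity ε hm B).aestronglyMeasurable).trans ?_
  calc ∫ ω, (blockDensity ε g B ^ 2) ω ∂P ≤ ∫ ω, R * blockDensity ε g B ω ∂P := by
        refine integral_mono (memLp_blockDensity hε hm B).integrable_sq
          ((integrable_blockDensity hε hm B).const_mul R) fun ω => ?_
        simp only [Pi.pow_apply, sq]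
        exact mul_le_mul_of_nonneg_right (blockDensity_le hε hB ω) (blockDensity_nonneg _ _ _)
    _ = R := by rw [integral_const_mul, integral_blockDensity hε hg hm hlaw, mul_one]

/-- The normalized block indicators of `K` disjoint blocks sum to about `K`, by Chebyshev. -/
theorem measureReal_sum_blockDensity_le [IsProbabilityMeasure P] {ε : ℝ} (hε : 0 < ε)
    (hg : iIndepFun g P) (hm : ∀ l, Measurable (g l))
    (hlaw : ∀ l, HasLaw (g l) (gaussianReal 0 1) P) {K D : ℕ} (hK : 0 < K)
    {B : Fin K → Finset ι} (hB : ∀ k, (B k).card ≤ D)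
    (hdisj : Pairwise fun j k => Disjoint (B j) (B k)) :
    P.real {ω | ∑ k, blockDensity ε g (B k) ω ≤ K / 2}
      ≤ 4 * (((gaussianReal 0 1).real {y | y ^ 2 ≤ ε})⁻¹) ^ D / K := by
  have hK' : (0 : ℝ) < K := by exact_mod_cast hK
  set R := (((gaussianReal 0 1).real {y | y ^ 2 ≤ ε})⁻¹) ^ D
  have hR : 0 ≤ R := by positivity
  set Y : Ω → ℝ := ∑ k, blockDensity ε g (B k) with hY
  have hYω : ∀ ω, Y ω = ∑ k, blockDensity ε g (B k) ω := fun ω => by simp [hY]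
  have hYL : MemLp Y 2 P := memLp_finsetSum' _ fun k _ => memLp_blockDensity hε hm (B k)
  have hmean : ∫ ω, Y ω ∂P = K := by
    simp_rw [hYω]
    rw [integral_finsetSum _ fun k _ => integrable_blockDensity hε hm (B k)]
    simp [integral_blockDensity hε hg hm hlaw]
  have hvar : Var[Y; P] ≤ K * R := by
    rw [hY, IndepFun.variance_sum (fun k _ => memLp_blockDensity hε hm (B k))
      fun j _ k _ hjk => indepFun_blockDensity ε hg hm (hdisj hjk)]
    calc _ ≤ ∑ k : Fin K, R :=
          Finset.sum_le_sum fun k _ => variance_blockDensity_le hε hg hm hlaw (hB k)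
      _ = K * R := by simp
  have hch := meas_ge_le_variance_div_sq hYL (c := (K : ℝ) / 2) (by positivity)
  rw [hmean] at hch
  calc P.real {ω | ∑ k, blockDensity ε g (B k) ω ≤ K / 2}
      ≤ P.real {ω | (K : ℝ) / 2 ≤ |Y ω - K|} := by
        refine measureReal_mono fun ω hω => ?_
        have h1 : Y ω ≤ K / 2 := by rw [hYω]; exact hω
        show (K : ℝ) / 2 ≤ |Y ω - K|
        rw [abs_sub_comm]
        exact le_trans (by linarith) (le_abs_self _)
    _ ≤ Var[Y; P] / (K / 2) ^ 2 :=
        ENNReal.toReal_le_of_le_ofReal (div_nonneg (variance_nonneg _ _) (by positivity)) hch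
    _ ≤ K * R / (K / 2) ^ 2 := by gcongr
    _ = 4 * R / K := by field_simp; norm_num

/-- If `Λ` is bounded by weighted averages of the squared coefficients around each of `K` disjoint
blocks, and the averages have little weight outside of their block, then `Λ` is small unless no
block consists of small coefficients. Averaging the `K` bounds with the normalized block indicators
avoids conditioning on a block: what lies outside of a block is independent of its indicator. -/
theorem measureReal_ge_le_of_blocks [IsProbabilityMeasure P] [Fintype ι] [DecidableEq ι]
    {ε : ℝ} (hε : 0 < ε) (hg : iIndepFun g P) (hm : ∀ l, Measurable (g l))
    (hlaw : ∀ l, HasLaw (g l) (gaussianReal 0 1) P) {K D : ℕ} (hK : 0 < K)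
    {B : Fin K → Finset ι} (hB : ∀ k, (B k).card ≤ D)
    (hdisj : Pairwise fun j k => Disjoint (B j) (B k))
    {σ : ι → ι} (hσ : ∀ k l, σ l ∈ B k ↔ l ∈ B k)
    {W : Fin K → ι → ℝ} (hW0 : ∀ k l, 0 ≤ W k l) (hW1 : ∀ k l, W k l ≤ 1) {η : ℝ}
    (hη : ∀ k, ∑ l ∈ (B k)ᶜ, W k l ≤ η) {Λ : Ω → ℝ} {C τ : ℝ} (hC : 0 ≤ C)
    (hΛ : ∀ ω k, Λ ω ≤ C * ∑ l, W k l * ((g l ω ^ 2 + g (σ l) ω ^ 2) / 2))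
    (hτ : 0 < τ) (hετ : 2 * (C * (D * ε)) ≤ τ) :
    P.real {ω | τ ≤ Λ ω}
      ≤ 4 * (((gaussianReal 0 1).real {y | y ^ 2 ≤ ε})⁻¹) ^ D / K + 4 * C * η / τ := by
  have hK' : (0 : ℝ) < K := by exact_mod_cast hK
  set Y : Fin K → Ω → ℝ := fun k => blockDensity ε g (B k) with hYdef
  have hY0 : ∀ k ω, 0 ≤ Y k ω := fun k ω => blockDensity_nonneg _ _ _
  set T : Fin K → Ω → ℝ := fun k ω =>
    ∑ l ∈ (B k)ᶜ, W k l * ((g l ω ^ 2 + g (σ l) ω ^ 2) / 2) with hTdef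
  have hT0 : ∀ k ω, 0 ≤ T k ω := fun k ω => Finset.sum_nonneg fun l _ =>
    mul_nonneg (hW0 k l) (by positivity)
  have hYT : ∀ k ω, Y k ω * T k ω = ∑ l ∈ (B k)ᶜ,
      (W k l / 2 * (Y k ω * g l ω ^ 2) + W k l / 2 * (Y k ω * g (σ l) ω ^ 2)) := by
    intro k ω
    rw [hTdef, Finset.mul_sum]
    exact Finset.sum_congr rfl fun l _ => by ring
  have hYgi : ∀ k l, Integrable (fun ω => Y k ω * g l ω ^ 2) P := fun k l =>
    integrable_blockDensity_mul hε hm (B k) (integrable_sq_of_hasLaw (hlaw l))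
  have hYg : ∀ k l, l ∉ B k → ∫ ω, Y k ω * g l ω ^ 2 ∂P = 1 := by
    intro k l hl
    rw [(indepFun_blockDensity_sq ε hg hm hl).integral_fun_mul_eq_mul_integral
      (measurable_blockDensity ε hm (B k)).aestronglyMeasurable
      ((hm l).pow_const 2).aestronglyMeasurable, integral_blockDensity hε hg hm hlaw,
      integral_sq_of_hasLaw (hlaw l), mul_one]
  have hli : ∀ k l, Integrable (fun ω =>
      W k l / 2 * (Y k ω * g l ω ^ 2) + W k l / 2 * (Y k ω * g (σ l) ω ^ 2)) P := fun k l =>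
    ((hYgi k l).const_mul _).add ((hYgi k (σ l)).const_mul _)
  have hYTi : ∀ k, Integrable (fun ω => Y k ω * T k ω) P := by
    intro k
    simp_rw [hYT]
    exact integrable_finsetSum _ fun l _ => hli k l
  have hYTe : ∀ k, ∫ ω, Y k ω * T k ω ∂P ≤ η := by
    intro k
    simp_rw [hYT]
    rw [integral_finsetSum _ fun l _ => hli k l]
    refine le_trans (le_of_eq (Finset.sum_congr rfl fun l hl => ?_)) (hη k)
    have hl' := Finset.mem_compl.1 hl
    rw [integral_add ((hYgi k l).const_mul _) ((hYgi k (σ l)).const_mul _), integral_const_mul,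
      integral_const_mul, hYg k l hl', hYg k (σ l) (fun h => hl' ((hσ k l).1 h))]
    ring
  have hpoint : ∀ k ω, Λ ω * Y k ω ≤ C * (D * ε) * Y k ω + C * (Y k ω * T k ω) := by
    intro k ω
    have hin : Y k ω * ∑ l ∈ B k, W k l * ((g l ω ^ 2 + g (σ l) ω ^ 2) / 2)
        ≤ Y k ω * (D * ε) := by
      rw [Finset.mul_sum]
      calc _ ≤ ∑ l ∈ B k, Y k ω * ε := by
            refine Finset.sum_le_sum fun l hl => ?_
            have h1 : Y k ω * g l ω ^ 2 ≤ Y k ω * ε := blockDensity_mul_sq_le ε ω hl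
            have h2 : Y k ω * g (σ l) ω ^ 2 ≤ Y k ω * ε :=
              blockDensity_mul_sq_le ε ω ((hσ k l).2 hl)
            have h3 : 0 ≤ Y k ω * ((g l ω ^ 2 + g (σ l) ω ^ 2) / 2) :=
              mul_nonneg (hY0 k ω) (by positivity)
            calc _ = W k l * (Y k ω * ((g l ω ^ 2 + g (σ l) ω ^ 2) / 2)) := by ring
              _ ≤ 1 * (Y k ω * ((g l ω ^ 2 + g (σ l) ω ^ 2) / 2)) :=
                  mul_le_mul_of_nonneg_right (hW1 k l) h3
              _ ≤ _ := by linarith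
        _ = (B k).card * (Y k ω * ε) := by simp
        _ ≤ D * (Y k ω * ε) := by
            have := hY0 k ω
            have := hB k
            gcongr
        _ = _ := by ring
    have hs := hΛ ω k
    rw [← Finset.sum_add_sum_compl (B k)] at hs
    calc Λ ω * Y k ω ≤ (C * (∑ l ∈ B k, W k l * ((g l ω ^ 2 + g (σ l) ω ^ 2) / 2) + T k ω))
          * Y k ω := mul_le_mul_of_nonneg_right hs (hY0 k ω)
      _ = C * (Y k ω * ∑ l ∈ B k, W k l * ((g l ω ^ 2 + g (σ l) ω ^ 2) / 2))
          + C * (Y k ω * T k ω) := by ring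
      _ ≤ C * (Y k ω * (D * ε)) + C * (Y k ω * T k ω) := by gcongr
      _ = _ := by ring
  set V : Ω → ℝ := fun ω => ∑ k, C * (Y k ω * T k ω) with hVdef
  have hV0 : ∀ ω, 0 ≤ V ω := fun ω => Finset.sum_nonneg fun k _ =>
    mul_nonneg hC (mul_nonneg (hY0 k ω) (hT0 k ω))
  have hVi : Integrable V P := integrable_finsetSum _ fun k _ => (hYTi k).const_mul C
  have hVe : ∫ ω, V ω ∂P ≤ C * (K * η) := by
    rw [hVdef, integral_finsetSum _ fun k _ => (hYTi k).const_mul C]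
    simp_rw [integral_const_mul]
    rw [← Finset.mul_sum]
    gcongr
    calc _ ≤ ∑ k : Fin K, η := Finset.sum_le_sum fun k _ => hYTe k
      _ = K * η := by simp
  have hcover : {ω | τ ≤ Λ ω} ⊆ {ω | ∑ k, Y k ω ≤ K / 2} ∪ {ω | τ * K / 4 ≤ V ω} := by
    intro ω hω
    by_contra hcon
    simp only [Set.mem_union, Set.mem_ofPred_eq, not_or, not_le] at hcon hω
    obtain ⟨h1, h2⟩ := hcon
    have h3 : Λ ω * ∑ k, Y k ω ≤ C * (D * ε) * ∑ k, Y k ω + V ω := by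
      rw [Finset.mul_sum, Finset.mul_sum, hVdef, ← Finset.sum_add_distrib]
      exact Finset.sum_le_sum fun k _ => hpoint k ω
    have h4 : τ / 2 * ∑ k, Y k ω ≤ (Λ ω - C * (D * ε)) * ∑ k, Y k ω :=
      mul_le_mul_of_nonneg_right (by linarith) (by linarith)
    have h5 : τ / 2 * (K / 2) < τ / 2 * ∑ k, Y k ω :=
      mul_lt_mul_of_pos_left h1 (by positivity)
    linarith
  have hMarkov : P.real {ω | τ * K / 4 ≤ V ω} ≤ 4 * C * η / τ := by
    have h := mul_meas_ge_le_integral_of_nonneg (Eventually.of_forall hV0) hVi (τ * K / 4)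
    have h' : τ * K / 4 * P.real {ω | τ * K / 4 ≤ V ω} ≤ τ * K / 4 * (4 * C * η / τ) := by
      refine (h.trans hVe).trans_eq ?_
      field_simp
    exact le_of_mul_le_mul_left h' (by positivity)
  calc P.real {ω | τ ≤ Λ ω} ≤ _ := measureReal_mono hcover
    _ ≤ _ := measureReal_union_le _ _
    _ ≤ _ := add_le_add (measureReal_sum_blockDensity_le hε hg hm hlaw hK hB hdisj) hMarkov

end Blocks

/-! ### Smallness in probability and in moments -/

section Limit

variable {Ω : Type*} [MeasurableSpace Ω] {P : Measure Ω}

/-- Convergence to zero in probability, with a threshold for the size `N` that is uniform in the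
number of rows `p ≥ δ * N` and in the realization of the noise. -/
theorem exists_measureReal_ge_le [IsProbabilityMeasure P] {δ τ θ : ℝ} (hδ : 0 < δ) (hτ : 0 < τ)
    (hθ : 0 < θ) :
    ∃ N₀ : ℕ, ∀ (N p : ℕ) [NeZero N] (f : ZMod N → Ω → ℝ) (Λ : Ω → ℝ), N₀ ≤ N → 0 < p → p ≤ N →
      δ * N ≤ p → iIndepFun f P → (∀ z, Measurable (f z)) →
      (∀ z, HasLaw (f z) (gaussianReal 0 1) P) →
      (∀ ω (u : Fin p → ℝ), Λ ω * ∑ i, u i ^ 2 ≤ 2 / N * convEnergy (fun z => f z ω) u) →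
      P.real {ω | τ ≤ Λ ω} ≤ θ := by
  -- The half-width `M` of the blocks controls the leakage of the Fejér weights, `ε` is small
  -- compared to the size `D` of the blocks, and the number `K` of blocks is chosen last.
  obtain ⟨M, hM⟩ := exists_nat_gt (8 / (δ * τ * θ))
  have hMpos : 0 < M := by
    have : (0 : ℝ) < M := lt_trans (by positivity) hM
    exact_mod_cast this
  set D : ℕ := 2 * (2 * M + 1) with hD
  have hDpos : (0 : ℝ) < D := by rw [hD]; positivity
  set ε : ℝ := τ / (4 * D)
  have hε : 0 < ε := by positivity
  set R : ℝ := (((gaussianReal 0 1).real {y | y ^ 2 ≤ ε})⁻¹) ^ D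
  have hR : 0 < R := pow_pos (inv_pos.2 (gaussianReal_sq_le_pos hε)) D
  obtain ⟨K, hK⟩ := exists_nat_gt (8 * R / θ)
  have hKpos' : (0 : ℝ) < K := lt_trans (by positivity) hK
  have hKpos : 0 < K := by exact_mod_cast hKpos'
  refine ⟨2 * ((2 * M + 1) * (K + 1) + M) + 1, ?_⟩
  intro N p _ f Λ hN hp hpN hδp hf hm hlaw hΛ
  have hM' : (0 : ℝ) < M := by exact_mod_cast hMpos
  have hp' : (0 : ℝ) < p := by exact_mod_cast hp
  have hN' : (0 : ℝ) < N := by exact_mod_cast NeZero.pos N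
  let c : Fin K → ℕ := fun k => (2 * M + 1) * (k + 1)
  have hc : ∀ j k : Fin K, j < k →
      Disjoint (freqBlock N M (c j : ZMod N)) (freqBlock N M (c k : ZMod N)) := by
    intro j k hjk
    have h1 : (j : ℕ) + 1 ≤ k := hjk
    have h2 : (k : ℕ) + 1 ≤ K := k.2
    refine disjoint_freqBlock ?_ ?_ ?_ <;> simp only [c]
    · nlinarith
    · nlinarith
    · nlinarith
  have hη : (N : ℝ) / (2 * p * M) ≤ 1 / (2 * δ * M) := by
    rw [div_le_div_iff₀ (by positivity) (by positivity)]
    nlinarith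
  have h := measureReal_ge_le_of_blocks (P := P) (g := fun l ω => hartley (fun z => f z ω) l)
    (σ := fun l => -l) (B := fun k => freqBlock N M (c k : ZMod N))
    (W := fun k l => fejerWeight p ((c k : ZMod N) - l)) (C := 2) (D := D) (Λ := Λ)
    (η := 1 / (2 * δ * M)) hε (iIndepFun_hartley hf hlaw)
    (measurable_hartley hm) (hasLaw_hartley hf hlaw) hKpos (fun k => card_freqBlock_le N M _)
    (fun j k hjk => by
      rcases lt_or_gt_of_ne hjk with h | h
      · exact hc j k h
      · exact (hc k j h).symm)
    (fun k l => neg_mem_freqBlock) (fun k l => fejerWeight_nonneg _ _)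
    (fun k l => fejerWeight_le_one hp hpN _)
    (fun k => (sum_fejerWeight_tail_le hp hMpos _ fun l hl =>
      lt_abs_valMinAbs_of_notMem_freqBlock hl).trans hη)
    (by norm_num) (fun ω k => le_sum_fejerWeight hp _ (hΛ ω) _) hτ
    (by simp only [ε]; field_simp; norm_num)
  refine h.trans ?_
  have h1 : 4 * R / K ≤ θ / 2 := by
    rw [div_lt_iff₀ hθ] at hK
    rw [div_le_iff₀ hKpos']
    linarith
  have h2 : 4 * 2 * (1 / (2 * δ * M)) / τ ≤ θ / 2 := by
    rw [div_lt_iff₀ (by positivity)] at hM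
    rw [div_le_iff₀ hτ, mul_one_div, div_le_iff₀ (by positivity)]
    linarith
  linarith

/-- Testing the quadratic form against the first coordinate vector. -/
theorem le_mean_sq_of_convEnergy {N p : ℕ} [NeZero N] (hp : 0 < p) {f : ZMod N → ℝ} {a C : ℝ}
    (h : ∀ u : Fin p → ℝ, a * ∑ i, u i ^ 2 ≤ C / N * convEnergy f u) :
    a ≤ C * ∑ z, (Fintype.card (ZMod N) : ℝ)⁻¹ * f z ^ 2 := by
  have h1 := h (Pi.single ⟨0, hp⟩ 1)
  have hs : ∑ i, (Pi.single (⟨0, hp⟩ : Fin p) (1 : ℝ) : Fin p → ℝ) i ^ 2 = 1 := by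
    simp [Pi.single_apply]
  have hc : convEnergy f (Pi.single (⟨0, hp⟩ : Fin p) (1 : ℝ)) = ∑ z, f z ^ 2 := by
    simp [convEnergy, Pi.single_apply]
  rw [hs, hc, mul_one] at h1
  rw [← Finset.mul_sum, ZMod.card, ← mul_assoc, ← div_eq_mul_inv]
  exact h1

theorem exists_integral_rpow_le [IsProbabilityMeasure P] {δ κ η : ℝ} (hδ : 0 < δ) (hκ : 1 ≤ κ)
    (hη : 0 < η) :
    ∃ N₀ : ℕ, ∀ (N p : ℕ) [NeZero N] (f : ZMod N → Ω → ℝ) (Λ : Ω → ℝ), N₀ ≤ N → 0 < p → p ≤ N →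
      δ * N ≤ p → iIndepFun f P → (∀ z, Measurable (f z)) →
      (∀ z, HasLaw (f z) (gaussianReal 0 1) P) → Measurable Λ → (∀ ω, 0 ≤ Λ ω) →
      (∀ ω (u : Fin p → ℝ), Λ ω * ∑ i, u i ^ 2 ≤ 2 / N * convEnergy (fun z => f z ω) u) →
      ∫ ω, Λ ω ^ κ ∂P ≤ η := by
  set m : ℝ := (2 : ℝ) ^ (2 * κ) * ∫ x, (x ^ 2) ^ (2 * κ) ∂(gaussianReal 0 1)
  have hm0 : 0 ≤ m := mul_nonneg (by positivity) (integral_nonneg fun x => by positivity)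
  set s : ℝ := η / (3 * (m + 1))
  have hs : 0 < s := by positivity
  set τ : ℝ := (η / 3) ^ κ⁻¹
  have hτ : 0 < τ := by positivity
  have hτκ : τ ^ κ = η / 3 := Real.rpow_inv_rpow (by positivity) (by linarith)
  obtain ⟨N₀, hN₀⟩ := exists_measureReal_ge_le (P := P) hδ hτ (θ := s * (η / 3)) (by positivity)
  refine ⟨N₀, fun N p _ f Λ hN hp hpN hδp hf hm hlaw hΛm hΛ0 hΛ => ?_⟩
  have hmean := fun ω => le_mean_sq_of_convEnergy hp (hΛ ω)
  have h1 := rpow_moment_le hlaw hΛm hΛ0 zero_le_two hmean hκ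
  have h2 := rpow_moment_le hlaw hΛm hΛ0 zero_le_two hmean (r := 2 * κ) (by linarith)
  have h3 := integral_rpow_le_of_tail hΛm hΛ0 (by linarith) hτ hs h1.1 h2.1
  have h4 := hN₀ N p f Λ hN hp hpN hδp hf hm hlaw hΛ
  have h5 : s * ∫ ω, Λ ω ^ (2 * κ) ∂P ≤ η / 3 := by
    calc _ ≤ s * (m + 1) := by
          have := h2.2
          gcongr
          linarith
      _ = η / 3 := by simp only [s]; field_simp
  have h6 : s⁻¹ * P.real {ω | τ ≤ Λ ω} ≤ η / 3 := by
    rw [inv_mul_le_iff₀ hs]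
    exact h4
  linarith

/-- The indices `e p` realize the noise of the `p`-th matrix as functions on `ZMod (N p)`. -/
theorem tendsto_integral_rpow [IsProbabilityMeasure P] {x : ℤ → Ω → ℝ} (hx : iIndepFun x P)
    (hm : ∀ i, Measurable (x i)) (hlaw : ∀ i, HasLaw (x i) (gaussianReal 0 1) P)
    {N : ℕ → ℕ} (hpN : ∀ᶠ p in atTop, p ≤ N p) {δ : ℝ} (hδ : 0 < δ)
    (hδN : ∀ᶠ p : ℕ in atTop, δ * N p ≤ p) {e : ∀ p, ZMod (N p) → ℤ}
    (he : ∀ᶠ p in atTop, Function.Injective (e p)) {Λ : ℕ → Ω → ℝ}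
    (hΛm : ∀ p, Measurable (Λ p)) (hΛ0 : ∀ p ω, 0 ≤ Λ p ω)
    (hΛ : ∀ᶠ p in atTop, ∀ [NeZero (N p)] (ω : Ω) (u : Fin p → ℝ),
      Λ p ω * ∑ i, u i ^ 2 ≤ 2 / N p * convEnergy (fun z => x (e p z) ω) u)
    {κ : ℝ} (hκ : 1 ≤ κ) :
    Tendsto (fun p => ∫ ω, Λ p ω ^ κ ∂P) atTop (𝓝 0) := by
  rw [Metric.tendsto_nhds]
  intro η hη
  obtain ⟨N₀, hN₀⟩ := exists_integral_rpow_le (P := P) hδ hκ (half_pos hη)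
  filter_upwards [hpN, hδN, he, hΛ, eventually_ge_atTop N₀, eventually_gt_atTop 0]
    with p h1 h2 h3 h4 h5 h6
  have : NeZero (N p) := ⟨by omega⟩
  have h := hN₀ (N p) p (fun z => x (e p z)) (Λ p) (h5.trans h1) h6 h1 h2 (hx.precomp h3)
    (fun z => hm _) (fun z => hlaw _) (hΛm p) (hΛ0 p) h4
  rw [Real.dist_eq, sub_zero, abs_of_nonneg (integral_nonneg fun ω => Real.rpow_nonneg (hΛ0 p ω) κ)]
  linarith

theorem integrable_rpow_of_convEnergy [IsProbabilityMeasure P] {N p : ℕ} [NeZero N] (hp : 0 < p)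
    {f : ZMod N → Ω → ℝ} (hlaw : ∀ z, HasLaw (f z) (gaussianReal 0 1) P) {Λ : Ω → ℝ}
    (hΛm : Measurable Λ) (hΛ0 : ∀ ω, 0 ≤ Λ ω) {b : ℝ} (hb : 0 ≤ b)
    (hΛ : ∀ ω (u : Fin p → ℝ), Λ ω * ∑ i, u i ^ 2 ≤ b * convEnergy (fun z => f z ω) u)
    {κ : ℝ} (hκ : 1 ≤ κ) : Integrable (fun ω => Λ ω ^ κ) P := by
  have hN : (N : ℝ) ≠ 0 := by exact_mod_cast NeZero.ne N
  refine (rpow_moment_le hlaw hΛm hΛ0 (C := b * N) (by positivity) (fun ω => ?_) hκ).1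
  refine le_mean_sq_of_convEnergy hp fun u => ?_
  rw [mul_div_cancel_right₀ _ hN]
  exact hΛ ω u

end Limit

/-! ### Circulant and Toeplitz matrices as circular convolutions -/

theorem sum_fin_natCast_le {N n : ℕ} [NeZero N] (hn : n ≤ N) {F : ZMod N → ℝ}
    (hF : ∀ z, 0 ≤ F z) : ∑ j : Fin n, F ((j : ℕ) : ZMod N) ≤ ∑ z, F z := by
  have hinj : Set.InjOn (fun j : Fin n => ((j : ℕ) : ZMod N)) (Finset.univ : Finset (Fin n)) := by
    intro a _ b _ hab
    have h := congrArg ZMod.val hab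
    simp only [ZMod.val_natCast] at h
    rw [Nat.mod_eq_of_lt (by omega), Nat.mod_eq_of_lt (by omega)] at h
    exact Fin.ext h
  rw [← Finset.sum_image (f := F) hinj]
  exact Finset.sum_le_sum_of_subset_of_nonneg (Finset.subset_univ _) fun z _ _ => hF z

theorem smallestEigenvalue_rectCirculant_le {n p : ℕ} [NeZero n] (hp : 0 < p) (x : ℤ → ℝ)
    (u : Fin p → ℝ) :
    smallestEigenvalue (sampleCov (rectCirculant x p n)) * ∑ i, u i ^ 2
      ≤ 1 / n * convEnergy (fun z : ZMod n => x z.val) u := by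
  refine (smallestEigenvalue_sampleCov_mul_le hp _ u).trans ?_
  gcongr
  refine le_trans (le_of_eq (Finset.sum_congr rfl fun j _ => ?_))
    (sum_fin_natCast_le (N := n) le_rfl fun z => sq_nonneg (∑ i : Fin p, u i * x (z - (i : ℕ)).val))
  congr 1
  refine Finset.sum_congr rfl fun i _ => ?_
  have h := ZMod.val_intCast (n := n) ((j : ℤ) - (i : ℤ))
  push_cast at h
  show u i * x (((j : ℤ) - (i : ℤ)) % n)
    = u i * x ((((j : ℕ) : ZMod n) - ((i : ℕ) : ZMod n)).val : ℤ)
  rw [h]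

/-- The index of the two-sided sequence sitting at position `z` of the first row of the circulant
matrix of size `N` that contains the Toeplitz matrix with `n` columns: the negative indices
`-(p - 1), …, -1` are placed after `0, …, n - 1`. -/
def wrapIndex (n N : ℕ) (z : ZMod N) : ℤ :=
  if z.val < n then z.val else z.val - N

theorem wrapIndex_injective (n N : ℕ) [NeZero N] : Function.Injective (wrapIndex n N) := by
  intro a b h
  have ha := ZMod.val_lt a
  have hb := ZMod.val_lt b
  apply ZMod.val_injective N
  unfold wrapIndex at h
  split_ifs at h <;> omega

/-- A `p × n` Toeplitz matrix consists of the first `n` columns of the `p × (n + p - 1)` circulant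
matrix of the rearranged sequence, and dropping columns decreases the quadratic form. -/
theorem smallestEigenvalue_rectToeplitz_le {n p : ℕ} [NeZero (n + p - 1)] (hp : 0 < p) (x : ℤ → ℝ)
    (u : Fin p → ℝ) :
    smallestEigenvalue (sampleCov (rectToeplitz x p n)) * ∑ i, u i ^ 2
      ≤ 1 / n * convEnergy (fun z => x (wrapIndex n (n + p - 1) z)) u := by
  refine (smallestEigenvalue_sampleCov_mul_le hp _ u).trans ?_
  gcongr
  refine le_trans (le_of_eq (Finset.sum_congr rfl fun j _ => ?_))
    (sum_fin_natCast_le (N := n + p - 1) (n := n) (by omega) fun z =>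
      sq_nonneg (∑ i : Fin p, u i * x (wrapIndex n (n + p - 1) (z - (i : ℕ)))))
  congr 1
  refine Finset.sum_congr rfl fun i _ => ?_
  have h := ZMod.val_intCast (n := n + p - 1) ((j : ℤ) - (i : ℤ))
  push_cast at h
  have hj := j.2
  have hi := i.2
  rw [rectToeplitz, Matrix.of_apply]
  congr 2
  unfold wrapIndex
  rcases le_or_gt 0 ((j : ℤ) - (i : ℤ)) with hs | hs
  · rw [Int.emod_eq_of_lt hs (by omega)] at h
    rw [if_pos (by omega), h]
  · rw [← Int.add_emod_right, Int.emod_eq_of_lt (by omega) (by omega)] at h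
    rw [if_neg (by omega), h]
    ring

/-! ### The two matrix models -/

section Models

variable {Ω : Type*} [MeasurableSpace Ω] {P : Measure Ω}

theorem measurable_smallestEigenvalue_comp {x : ℤ → Ω → ℝ} (hm : ∀ i, Measurable (x i)) {p n : ℕ}
    {X : (ℤ → ℝ) → Matrix (Fin p) (Fin n) ℝ} (hX : ∀ i j, Continuous fun y => X y i j) :
    Measurable fun ω => smallestEigenvalue (sampleCov (X fun i => x i ω)) :=
  (measurable_smallestEigenvalue_sampleCov hX).comp (measurable_pi_iff.2 hm)

theorem integrable_rpow_of_subsingleton [IsFiniteMeasure P] (x : ℤ → Ω → ℝ) {p n : ℕ}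
    (h : p = 0 ∨ n = 0) (X : (ℤ → ℝ) → Matrix (Fin p) (Fin n) ℝ) (κ : ℝ) :
    Integrable (fun ω => smallestEigenvalue (sampleCov (X fun i => x i ω)) ^ κ) P := by
  have hs : Subsingleton (Matrix (Fin p) (Fin n) ℝ) := by
    rcases h with rfl | rfl
    · exact ⟨fun A B => by ext i; exact i.elim0⟩
    · exact ⟨fun A B => by ext i j; exact j.elim0⟩
  have hc : ∀ ω, X (fun i => x i ω) = 0 := fun ω => Subsingleton.elim _ _
  simp_rw [hc]
  exact integrable_const _

theorem continuous_rectToeplitz_apply (p n : ℕ) (i : Fin p) (j : Fin n) :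
    Continuous fun y => rectToeplitz y p n i j := by
  simp only [rectToeplitz, Matrix.of_apply]
  fun_prop

theorem continuous_rectCirculant_apply (p n : ℕ) (i : Fin p) (j : Fin n) :
    Continuous fun y => rectCirculant y p n i j := by
  simp only [rectCirculant, Matrix.of_apply]
  fun_prop

variable [IsProbabilityMeasure P] {x : ℤ → Ω → ℝ}

theorem integrable_rpow_rectToeplitz (hm : ∀ i, Measurable (x i))
    (hlaw : ∀ i, HasLaw (x i) (gaussianReal 0 1) P) (p n : ℕ) {κ : ℝ} (hκ : 1 ≤ κ) :
    Integrable (fun ω =>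
      smallestEigenvalue (sampleCov (rectToeplitz (fun i => x i ω) p n)) ^ κ) P := by
  by_cases h : p = 0 ∨ n = 0
  · exact integrable_rpow_of_subsingleton x h (fun y => rectToeplitz y p n) κ
  · have : NeZero (n + p - 1) := ⟨by omega⟩
    exact integrable_rpow_of_convEnergy (p := p) (by omega) (fun z => hlaw (wrapIndex n _ z))
      (measurable_smallestEigenvalue_comp hm (continuous_rectToeplitz_apply p n))
      (fun ω => smallestEigenvalue_sampleCov_nonneg _) (b := 1 / n) (by positivity)
      (fun ω u => smallestEigenvalue_rectToeplitz_le (by omega) _ u) hκ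

theorem integrable_rpow_rectCirculant (hm : ∀ i, Measurable (x i))
    (hlaw : ∀ i, HasLaw (x i) (gaussianReal 0 1) P) (p n : ℕ) {κ : ℝ} (hκ : 1 ≤ κ) :
    Integrable (fun ω =>
      smallestEigenvalue (sampleCov (rectCirculant (fun i => x i ω) p n)) ^ κ) P := by
  by_cases h : p = 0 ∨ n = 0
  · exact integrable_rpow_of_subsingleton x h (fun y => rectCirculant y p n) κ
  · have : NeZero n := ⟨by omega⟩
    exact integrable_rpow_of_convEnergy (p := p) (by omega) (fun z : ZMod n => hlaw z.val)
      (measurable_smallestEigenvalue_comp hm (continuous_rectCirculant_apply p n))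
      (fun ω => smallestEigenvalue_sampleCov_nonneg _) (b := 1 / n) (by positivity)
      (fun ω u => smallestEigenvalue_rectCirculant_le (by omega) _ u) hκ

theorem tendsto_integral_rpow_rectToeplitz (hx : iIndepFun x P) (hm : ∀ i, Measurable (x i))
    (hlaw : ∀ i, HasLaw (x i) (gaussianReal 0 1) P) {n : ℕ → ℕ} (hpn : ∀ᶠ p in atTop, p ≤ n p)
    {δ : ℝ} (hδ : 0 < δ) (hδn : ∀ᶠ p : ℕ in atTop, δ * n p ≤ p) {κ : ℝ} (hκ : 1 ≤ κ) :
    Tendsto (fun p => ∫ ω,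
      smallestEigenvalue (sampleCov (rectToeplitz (fun i => x i ω) p (n p))) ^ κ ∂P)
      atTop (𝓝 0) := by
  have hN : ∀ p, p ≤ n p → ((n p + p - 1 : ℕ) : ℝ) ≤ 2 * n p := fun p hp => by
    have : n p + p - 1 ≤ 2 * n p := by omega
    exact_mod_cast this
  refine tendsto_integral_rpow hx hm hlaw (N := fun p => n p + p - 1) (δ := δ / 2)
    (e := fun p => wrapIndex (n p) _)
    (Λ := fun p ω => smallestEigenvalue (sampleCov (rectToeplitz (fun i => x i ω) p (n p))))
    ?_ (half_pos hδ) ?_ ?_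
    (fun p => measurable_smallestEigenvalue_comp (X := fun y => rectToeplitz y p (n p)) hm
      (continuous_rectToeplitz_apply p (n p)))
    (fun p ω => smallestEigenvalue_sampleCov_nonneg (rectToeplitz (fun i => x i ω) p (n p))) ?_ hκ
  · filter_upwards [hpn] with p hp
    omega
  · filter_upwards [hpn, hδn] with p hp h
    nlinarith [hN p hp]
  · filter_upwards [hpn, eventually_gt_atTop 0] with p hp hp0
    have : NeZero (n p + p - 1) := ⟨by omega⟩
    exact wrapIndex_injective _ _
  · filter_upwards [hpn, eventually_gt_atTop 0] with p hp hp0 _ ω u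
    refine (smallestEigenvalue_rectToeplitz_le hp0 _ u).trans ?_
    refine mul_le_mul_of_nonneg_right ?_ (Finset.sum_nonneg fun z _ => sq_nonneg _)
    have h1 : (0 : ℝ) < n p := by exact_mod_cast (by omega : 0 < n p)
    have h2 : (0 : ℝ) < (n p + p - 1 : ℕ) := by exact_mod_cast (by omega : 0 < n p + p - 1)
    rw [div_le_div_iff₀ h1 h2, one_mul]
    exact hN p hp

theorem tendsto_integral_rpow_rectCirculant (hx : iIndepFun x P) (hm : ∀ i, Measurable (x i))
    (hlaw : ∀ i, HasLaw (x i) (gaussianReal 0 1) P) {n : ℕ → ℕ} (hpn : ∀ᶠ p in atTop, p ≤ n p)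
    {δ : ℝ} (hδ : 0 < δ) (hδn : ∀ᶠ p : ℕ in atTop, δ * n p ≤ p) {κ : ℝ} (hκ : 1 ≤ κ) :
    Tendsto (fun p => ∫ ω,
      smallestEigenvalue (sampleCov (rectCirculant (fun i => x i ω) p (n p))) ^ κ ∂P)
      atTop (𝓝 0) := by
  refine tendsto_integral_rpow hx hm hlaw hpn hδ hδn (e := fun p z => (z.val : ℤ))
    (Λ := fun p ω => smallestEigenvalue (sampleCov (rectCirculant (fun i => x i ω) p (n p)))) ?_
    (fun p => measurable_smallestEigenvalue_comp (X := fun y => rectCirculant y p (n p)) hm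
      (continuous_rectCirculant_apply p (n p)))
    (fun p ω => smallestEigenvalue_sampleCov_nonneg (rectCirculant (fun i => x i ω) p (n p))) ?_ hκ
  · filter_upwards [hpn, eventually_gt_atTop 0] with p hp hp0
    have : NeZero (n p) := ⟨by omega⟩
    exact fun a b h => ZMod.val_injective _ (Nat.cast_injective (R := ℤ) h)
  · filter_upwards [eventually_gt_atTop 0] with p hp0 _ ω u
    refine (smallestEigenvalue_rectCirculant_le hp0 _ u).trans ?_
    refine mul_le_mul_of_nonneg_right ?_ (Finset.sum_nonneg fun z _ => sq_nonneg _)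
    gcongr
    norm_num

end Models

theorem theorem2 {Ω : Type*} [MeasurableSpace Ω] (P : Measure Ω) [IsProbabilityMeasure P]
    (x : ℤ → Ω → ℝ)
    (hx_indep : iIndepFun x P)
    (hx_law : ∀ i : ℤ, HasLaw (x i) (gaussianReal 0 1) P)
    (n : ℕ → ℕ) (hpn : ∀ᶠ p : ℕ in atTop, p ≤ n p)
    (c : ℝ) (hc0 : 0 < c) (hc1 : c ≤ 1)
    (hc : Tendsto (fun p : ℕ => (p : ℝ) / (n p : ℝ)) atTop (𝓝 c))
    (κ : ℝ) (hκ : 1 ≤ κ) :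
    ((∀ p : ℕ, Integrable (fun ω =>
          smallestEigenvalue (sampleCov (rectToeplitz (fun i => x i ω) p (n p))) ^ κ) P) ∧
      Tendsto (fun p : ℕ => ∫ ω,
          smallestEigenvalue (sampleCov (rectToeplitz (fun i => x i ω) p (n p))) ^ κ ∂P)
        atTop (𝓝 0)) ∧
    ((∀ p : ℕ, Integrable (fun ω =>
          smallestEigenvalue (sampleCov (rectCirculant (fun i => x i ω) p (n p))) ^ κ) P) ∧
      Tendsto (fun p : ℕ => ∫ ω,
          smallestEigenvalue (sampleCov (rectCirculant (fun i => x i ω) p (n p))) ^ κ ∂P)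
        atTop (𝓝 0)) := by
  -- The variables are only almost everywhere measurable, so measurable versions replace them.
  let y : ℤ → Ω → ℝ := fun i => (hx_law i).aemeasurable.mk (x i)
  have hxy : ∀ i, x i =ᵐ[P] y i := fun i => (hx_law i).aemeasurable.ae_eq_mk
  have hym : ∀ i, Measurable (y i) := fun i => (hx_law i).aemeasurable.measurable_mk
  have hy : iIndepFun y P := hx_indep.congr hxy
  have hylaw : ∀ i, HasLaw (y i) (gaussianReal 0 1) P := fun i => (hx_law i).congr (hxy i).symm
  have hae : ∀ᵐ ω ∂P, (fun i => y i ω) = fun i => x i ω := by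
    filter_upwards [ae_all_iff.2 hxy] with ω h
    exact funext fun i => (h i).symm
  have hδn : ∀ᶠ p : ℕ in atTop, c / 2 * n p ≤ p := by
    filter_upwards [hc.eventually_const_lt (half_lt_self hc0), hpn, eventually_gt_atTop 0]
      with p h1 h2 h3
    have h4 : (0 : ℝ) < n p := by exact_mod_cast (by omega : 0 < n p)
    exact ((lt_div_iff₀ h4).1 h1).le
  have hT : ∀ p : ℕ,
      (fun ω => smallestEigenvalue (sampleCov (rectToeplitz (fun i => y i ω) p (n p))) ^ κ)
        =ᵐ[P] fun ω =>
          smallestEigenvalue (sampleCov (rectToeplitz (fun i => x i ω) p (n p))) ^ κ := fun p => by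
    filter_upwards [hae] with ω h
    rw [h]
  have hC : ∀ p : ℕ,
      (fun ω => smallestEigenvalue (sampleCov (rectCirculant (fun i => y i ω) p (n p))) ^ κ)
        =ᵐ[P] fun ω =>
          smallestEigenvalue (sampleCov (rectCirculant (fun i => x i ω) p (n p))) ^ κ := fun p => by
    filter_upwards [hae] with ω h
    rw [h]
  refine ⟨⟨fun p => (integrable_rpow_rectToeplitz hym hylaw p (n p) hκ).congr (hT p), ?_⟩,
    fun p => (integrable_rpow_rectCirculant hym hylaw p (n p) hκ).congr (hC p), ?_⟩
  · exact (tendsto_integral_rpow_rectToeplitz hy hym hylaw hpn (half_pos hc0) hδn hκ).congr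
      fun p => integral_congr_ae (hT p)
  · exact (tendsto_integral_rpow_rectCirculant hy hym hylaw hpn (half_pos hc0) hδn hκ).congr
      fun p => integral_congr_ae (hC p)
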